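/- Let $d\ge 1$, let $\mathbb M_d=M_d(\mathbb C)$ with trace norm $\|\cdot\|_1$, and let $\mathcal S_d\subset\mathbb M_d$ be the set of density matrices. For a linear map $T:\mathbb M_d\to\mathbb M_d$ let $\|T\|_{1\to1}$ be the norm induced by $\|\cdot\|_1$, and put $$\kappa_{\rm tr}(T):=\sup\Big\{\tfrac{\|T(X)\|_1}{\|X\|_1}: X=X^*,\ \operatorname{tr}X=0,\ X\neq0\Big\}\qquad(\sup\emptyset:=0).$$ Let $(\Omega,\mathcal F,\mathbb P,\theta)$ be an invertible probability-preserving system and $\omega\mapsto\Phi_\omega$ a measurable family of completely positive trace-preserving maps on $\mathbb M_d$. For integers $s<t$ let $\Phi_{\omega;t:s}:=\Phi_{\theta^{t-1}\omega}\circ\cdots\circ\Phi_{\theta^{s}\omega}$, and let $$\lambda_{\rm tr}(\omega):=\lim_{n\to\infty}\tfrac1n\log\kappa_{\rm tr}(\Phi_{\omega;n:0})\in[-\infty,0]\qquad(\log 0:=-\infty),$$ a limit which exists for $\mathbb P$-a.e. $\omega$. Put $X_j(\omega):=\Phi_{\theta^j\omega}$ for $j\in\mathbb Z$, and for $m\ge1$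 define the maximal-correlation mixing coefficient $$\varrho_m:=\sup_{k\in\mathbb Z}\ \sup_{U,V}\big|\mathbb E[UV]\big|,$$ the inner supremum being over real $U\in L^2(\sigma(X_j:j<k))$ and $V\in L^2(\sigma(X_j:j\ge k+m))$ with $\mathbb E[U]=\mathbb E[V]=0$ and $\|U\|_2=\|V\|_2=1$ (and equal to $0$ if there are no such $U,V$). Theorem. Assume that $\lambda_{\rm tr}(\omega)<0$ for $\mathbb P$-a.e. $\omega$. Then there is a measurable map $\rho:\Omega\to\mathcal S_d$, unique up to $\mathbb P$-a.e. equality, such that $\Phi_\omega(\rho_\omega)=\rho_{\theta\omega}$ for $\mathbb P$-a.e. $\omega$. Put $R_\omega(X):=\operatorname{tr}(X)\rho_\omega$ and $$\Delta_n(\omega):=\max\big\{\|\Phi_{\omega;n:0}-R_{\theta^n\omega}\|_{1\to1},\ \|\Phi_{\omega;0:-n}-R_\omega\|_{1\to1}\big\}.$$ Then $\Delta_n$ is integrable for every $n\ge1$, and the following hold. 1. If $\varrho_m\to0$ as $m\to\infty$, then for every $p\in\mathbb N$ there is $C_p<\infty$ such that $\mathbb E[\Delta_n]\le C_p\,n^{-p}$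 for all $n\ge1$. 2. If the random variables $(X_j)_{j\in\mathbb Z}$ are independent, then there are $C<\infty$ and $\gamma>0$ such that $\mathbb E[\Delta_n]\le C e^{-\gamma n}$ for all $n\ge1$. -/

import Mathlib

open MeasureTheory ProbabilityTheory Filter Topology

noncomputable section

namespace RandomChannels

/-- The algebra of complex `d × d` matrices. -/
abbrev Mat (d : ℕ) : Type := Matrix (Fin d) (Fin d) ℂ

/-- Superoperators: complex-linear maps on `d × d` matrices. -/
abbrev Superop (d : ℕ) : Type := Mat d →ₗ[ℂ] Mat d

/-- The Borel σ-algebra of the finite-dimensional space of superoperators, described as the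
σ-algebra generated by all the matrix entries `T ↦ (T X) i j`. -/
instance superopMeasurableSpace (d : ℕ) : MeasurableSpace (Superop d) :=
  ⨆ (X : Mat d) (i : Fin d) (j : Fin d),
    MeasurableSpace.comap (fun T : Superop d => T X i j) inferInstance

/-- Trace norm: the sum of the singular values, i.e. of the square roots of the eigenvalues
of `Aᴴ A`. -/
def traceNorm {d : ℕ} (A : Mat d) : ℝ :=
  ∑ i, √((Matrix.isHermitian_conjTranspose_mul_self A).eigenvalues i)

open scoped ComplexOrder in
/-- Density matrices. -/
def IsState {d : ℕ} (ρ : Mat d) : Prop :=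
  ρ.PosSemidef ∧ ρ.trace = 1

open scoped ComplexOrder Matrix.Norms.L2Operator MatrixOrder CStarAlgebra in
/-- Completely positive trace-preserving maps (quantum channels). Complete positivity is Mathlib's
notion for the C⋆-algebra of `d × d` matrices (operator norm, Loewner order). -/
def IsCPTP {d : ℕ} (T : Superop d) : Prop :=
  (∃ φ : Mat d →CP Mat d, φ.toLinearMap = T) ∧ ∀ X, (T X).trace = X.trace

/-- The norm of a superoperator induced by the trace norm. -/
def oneOneNorm {d : ℕ} (T : Superop d) : ℝ :=
  sSup {r : ℝ | ∃ X : Mat d, X ≠ 0 ∧ r = traceNorm (T X) / traceNorm X}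

/-- The centered trace-Dobrushin coefficient. (For `d = 1` the set is empty and the value is `0`.) -/
def kappaTr {d : ℕ} (T : Superop d) : ℝ :=
  sSup {r : ℝ | ∃ X : Mat d, X.IsHermitian ∧ X.trace = 0 ∧ X ≠ 0 ∧
    r = traceNorm (T X) / traceNorm X}

/-- The replacement map `X ↦ tr(X) ρ`. -/
def replacement {d : ℕ} (ρ : Mat d) : Superop d :=
  (Matrix.traceLinearMap (Fin d) ℂ ℂ).smulRight ρ

section Cocycle

variable {Ω : Type*} [MeasurableSpace Ω] {d : ℕ}

/-- `θ^j ω` for an integer `j`. -/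
def shift (θ : Ω ≃ᵐ Ω) (j : ℤ) (ω : Ω) : Ω :=
  ((θ.toEquiv : Equiv.Perm Ω) ^ j) ω

/-- The channel process `X_j(ω) = Φ_{θ^j ω}`. -/
def channelAt (θ : Ω ≃ᵐ Ω) (Φ : Ω → Superop d) (j : ℤ) (ω : Ω) : Superop d :=
  Φ (shift θ j ω)

/-- The product of the `n` channels at times `s, s+1, …, s+n-1`, the earliest applied first. -/
def channelProd (θ : Ω ≃ᵐ Ω) (Φ : Ω → Superop d) (ω : Ω) (s : ℤ) : ℕ → Superop d
  | 0 => LinearMap.id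
  | n + 1 => channelAt θ Φ (s + n) ω ∘ₗ channelProd θ Φ ω s n

/-- The propagator `Φ_{ω;t:s} = Φ_{θ^{t-1}ω} ∘ ⋯ ∘ Φ_{θ^s ω}`, for `s ≤ t`. -/
def propagator (θ : Ω ≃ᵐ Ω) (Φ : Ω → Superop d) (ω : Ω) (t s : ℤ) : Superop d :=
  channelProd θ Φ ω s (t - s).toNat

/-- The trace-Dobrushin Lyapunov exponent `lim (1/n) log κ_n(ω) ∈ [-∞, 0]`, with `log 0 = -∞`.
It is written as a lower limit so as to be defined at every `ω`; it is the limit wherever the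
limit exists, which is almost everywhere by Kingman's theorem. -/
def lyapunovTr (θ : Ω ≃ᵐ Ω) (Φ : Ω → Superop d) (ω : Ω) : EReal :=
  liminf (fun n : ℕ =>
    ENNReal.log (ENNReal.ofReal (kappaTr (propagator θ Φ ω n 0))) / (n : EReal)) atTop

/-- Dynamically stationary random state: a measurable map `ρ` from `Ω` to the density matrices with
`Φ_ω(ρ_ω) = ρ_{θω}` almost surely. -/
structure IsStationaryState (μ : Measure Ω) (θ : Ω ≃ᵐ Ω) (Φ : Ω → Superop d)
    (ρ : Ω → Mat d) : Prop where
  measurable : ∀ i j, Measurable fun ω => ρ ω i j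
  isState : ∀ ω, IsState (ρ ω)
  stationary : ∀ᵐ ω ∂μ, Φ ω (ρ ω) = ρ (θ ω)

/-- The maximum of the forward and the pullback replacement errors over `n` steps. -/
def replacementError (θ : Ω ≃ᵐ Ω) (Φ : Ω → Superop d) (ρ : Ω → Mat d) (n : ℕ) (ω : Ω) : ℝ :=
  max (oneOneNorm (propagator θ Φ ω n 0 - replacement (ρ (shift θ n ω))))
    (oneOneNorm (propagator θ Φ ω 0 (-n) - replacement (ρ ω)))

/-- The σ-algebra generated by the channels at times `j < k`. -/
abbrev pastSigma (θ : Ω ≃ᵐ Ω) (Φ : Ω → Superop d) (k : ℤ) : MeasurableSpace Ω :=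
  ⨆ j ∈ Set.Iio k, MeasurableSpace.comap (channelAt θ Φ j) inferInstance

/-- The σ-algebra generated by the channels at times `j ≥ k`. -/
abbrev futureSigma (θ : Ω ≃ᵐ Ω) (Φ : Ω → Superop d) (k : ℤ) : MeasurableSpace Ω :=
  ⨆ j ∈ Set.Ici k, MeasurableSpace.comap (channelAt θ Φ j) inferInstance

/-- The maximal-correlation coefficient of two sub-σ-algebras (`0` if the class is empty). -/
def maxCorr (μ : Measure Ω) (𝒜 ℬ : MeasurableSpace Ω) : ℝ :=
  sSup {r : ℝ | ∃ U V : Ω → ℝ,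
    Measurable[𝒜] U ∧ Measurable[ℬ] V ∧ MemLp U 2 μ ∧ MemLp V 2 μ ∧
    ∫ ω, U ω ∂μ = 0 ∧ ∫ ω, V ω ∂μ = 0 ∧
    ∫ ω, U ω ^ 2 ∂μ = 1 ∧ ∫ ω, V ω ^ 2 ∂μ = 1 ∧
    r = |∫ ω, U ω * V ω ∂μ|}

/-- The maximal-correlation mixing coefficient of the channel environment at gap `m`. -/
def varrho (μ : Measure Ω) (θ : Ω ≃ᵐ Ω) (Φ : Ω → Superop d) (m : ℕ) : ℝ :=
  ⨆ k : ℤ, maxCorr μ (pastSigma θ Φ k) (futureSigma θ Φ (k + m))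

end Cocycle

end RandomChannels

end

open RandomChannels

/-! Everything reduces to the mean `c n` of the trace-Dobrushin coefficient κ of a product of `n`
channels; by invariance of the measure it does not depend on the starting time. If `T` is a product
of channels and `ρ` a state, then `T` minus replacement by `T ρ` sends `X` to `T (X - tr X • ρ)`,
and the argument is traceless, so the norm is at most `4 κ(T)`. Stationarity identifies `T ρ` with
the state at the final time, whence the mean error is at most `8 c n`.

Positive trace-preserving maps preserve traceless Hermitian matrices and contract their trace norm,
so κ is submultiplicative and at most 1. A negative exponent makes the forward coefficients vanish
almost surely, and dominated convergence gives `c n → 0`. The pullback coefficients decrease to a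
limit whose integral is at most every `c n`, so they vanish almost surely too. Hence orbits started
in the remote past are Cauchy, which gives the stationary state and its uniqueness.

For the rates, split a product into two blocks of length `a` separated by a gap `m` and discard the
gap. A `[0,1]`-valued variable has variance at most its mean, so the covariance of the two block
coefficients is at most `varrho m * c a`, and `c (2a+m) ≤ (c a + varrho m) * c a`. With `m` fixed
and `a` large the factor is as small as desired while the length grows by a bounded factor: this
beats every power of `n` (`integral_contraction_gap_le`, `exists_le_div_pow_of_doubling`). Under
independence there is no covariance term, and `c (m+n) ≤ c m * c n` with `c n → 0` forces
exponential decay. -/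

open RandomChannels

namespace RandomChannels

/-! ### Trace norm and its duality with the operator norm -/

section TraceNorm

open scoped Matrix Matrix.Norms.L2Operator

variable {d : ℕ}

lemma traceNorm_nonneg (A : Mat d) : 0 ≤ traceNorm A :=
  Finset.sum_nonneg fun _ _ => Real.sqrt_nonneg _

lemma trace_eq_sum_inner_toEuclideanCLM (A : Mat d)
    (b : OrthonormalBasis (Fin d) ℂ (EuclideanSpace ℂ (Fin d))) :
    A.trace = ∑ i, inner ℂ (b i) (Matrix.toEuclideanCLM (𝕜 := ℂ) A (b i)) := by
  have h := LinearMap.trace_eq_sum_inner (Matrix.toEuclideanLin A) b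
  have h2 : LinearMap.trace ℂ _ (Matrix.toEuclideanLin A) = A.trace := by
    rw [Matrix.toEuclideanLin_eq_toLin_orthonormal, Matrix.trace_toLin_eq]
  rw [← h2, h]
  rfl

/-- The trace pairing is bounded by the operator norm times the sum of the lengths of the columns
in any orthonormal basis. -/
lemma norm_trace_mul_le_sum (W A : Mat d)
    (b : OrthonormalBasis (Fin d) ℂ (EuclideanSpace ℂ (Fin d))) :
    ‖(W * A).trace‖ ≤ ‖W‖ * ∑ i, ‖Matrix.toEuclideanCLM (𝕜 := ℂ) A (b i)‖ := by
  rw [trace_eq_sum_inner_toEuclideanCLM _ b, Finset.mul_sum]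
  refine (norm_sum_le _ _).trans (Finset.sum_le_sum fun i _ => ?_)
  refine (norm_inner_le_norm _ _).trans ?_
  rw [b.norm_eq_one, one_mul, map_mul]
  exact ContinuousLinearMap.le_opNorm (Matrix.toEuclideanCLM (𝕜 := ℂ) W) _

lemma norm_toEuclideanCLM_eigenvectorBasis {A : Mat d} (hA : A.IsHermitian) (i : Fin d) :
    ‖Matrix.toEuclideanCLM (𝕜 := ℂ) A (hA.eigenvectorBasis i)‖ = |hA.eigenvalues i| := by
  have h : Matrix.toEuclideanCLM (𝕜 := ℂ) A (hA.eigenvectorBasis i)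
      = hA.eigenvalues i • hA.eigenvectorBasis i := by
    apply (WithLp.ofLp_injective 2)
    rw [Matrix.ofLp_toEuclideanCLM, hA.mulVec_eigenvectorBasis]
    rfl
  rw [h, norm_smul, OrthonormalBasis.norm_eq_one, mul_one, Real.norm_eq_abs]

/-- For a unit eigenvector `v` of `Aᴴ A`, `‖A v‖² = ⟨v, Aᴴ A v⟩` is the eigenvalue. In this basis
the sum of column lengths in `norm_trace_mul_le_sum` becomes the trace norm. -/
lemma norm_toEuclideanCLM_singular (A : Mat d) (i : Fin d) :
    ‖Matrix.toEuclideanCLM (𝕜 := ℂ) A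
      ((Matrix.isHermitian_conjTranspose_mul_self A).eigenvectorBasis i)‖
      = √((Matrix.isHermitian_conjTranspose_mul_self A).eigenvalues i) := by
  set hA := Matrix.isHermitian_conjTranspose_mul_self A
  set v := hA.eigenvectorBasis i
  have h : Matrix.toEuclideanCLM (𝕜 := ℂ) (Aᴴ * A) v = hA.eigenvalues i • v := by
    apply (WithLp.ofLp_injective 2)
    rw [Matrix.ofLp_toEuclideanCLM, hA.mulVec_eigenvectorBasis]
    rfl
  have h2 : (‖Matrix.toEuclideanCLM (𝕜 := ℂ) A v‖ ^ 2 : ℝ) = hA.eigenvalues i := by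
    have h3 : inner ℂ v (Matrix.toEuclideanCLM (𝕜 := ℂ) (Aᴴ * A) v)
        = (‖Matrix.toEuclideanCLM (𝕜 := ℂ) A v‖ ^ 2 : ℂ) := by
      rw [map_mul, ← Matrix.star_eq_conjTranspose, map_star, ContinuousLinearMap.star_eq_adjoint,
        mul_apply_eq_comp, ContinuousLinearMap.adjoint_inner_right,
        inner_self_eq_norm_sq_to_K]
      rfl
    rw [h, inner_smul_right_eq_smul, inner_self_eq_norm_sq_to_K,
      OrthonormalBasis.norm_eq_one] at h3
    have h4 := congrArg Complex.re h3
    norm_cast at h4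
    simpa using h4.symm
  rw [← h2, Real.sqrt_sq (norm_nonneg _)]

/-- Duality between trace norm and operator norm. -/
lemma norm_trace_mul_le (W A : Mat d) : ‖(W * A).trace‖ ≤ ‖W‖ * traceNorm A := by
  have h := norm_trace_mul_le_sum W A
    (Matrix.isHermitian_conjTranspose_mul_self A).eigenvectorBasis
  simp only [norm_toEuclideanCLM_singular] at h
  exact h

lemma norm_unitary_conj_diagonal (U : Matrix.unitaryGroup (Fin d) ℂ) (f : Fin d → ℂ) :
    ‖(U : Mat d) * Matrix.diagonal f * star (U : Mat d)‖ = ‖f‖ := by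
  have := CStarRing.norm_mul_coe_unitary ((U : Mat d) * Matrix.diagonal f) (star U)
  rw [Unitary.coe_star] at this
  rw [this, CStarRing.norm_coe_unitary_mul, Matrix.l2_opNorm_diagonal]

lemma spectral_decomposition {A : Mat d} (hA : A.IsHermitian) :
    A = (hA.eigenvectorUnitary : Mat d) * Matrix.diagonal (fun i => (hA.eigenvalues i : ℂ)) *
      star (hA.eigenvectorUnitary : Mat d) := by
  have := hA.spectral_theorem
  rw [Unitary.conjStarAlgAut_apply] at this
  exact this

/-- Product of two matrices diagonal in the same unitary basis. -/
lemma unitary_conj_diagonal_mul (U : Matrix.unitaryGroup (Fin d) ℂ) (f g : Fin d → ℂ) :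
    ((U : Mat d) * Matrix.diagonal f * star (U : Mat d)) *
      ((U : Mat d) * Matrix.diagonal g * star (U : Mat d)) =
      (U : Mat d) * Matrix.diagonal (fun i => f i * g i) * star (U : Mat d) := by
  have hU : star (U : Mat d) * (U : Mat d) = 1 := Unitary.coe_star_mul_self U
  calc _ = (U : Mat d) * Matrix.diagonal f * (star (U : Mat d) * (U : Mat d)) *
        Matrix.diagonal g * star (U : Mat d) := by simp only [mul_assoc]
    _ = _ := by rw [hU, mul_one, mul_assoc (U : Mat d), Matrix.diagonal_mul_diagonal]

lemma trace_unitary_conj_diagonal (U : Matrix.unitaryGroup (Fin d) ℂ) (f : Fin d → ℂ) :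
    ((U : Mat d) * Matrix.diagonal f * star (U : Mat d)).trace = ∑ i, f i := by
  rw [Matrix.trace_mul_comm, ← mul_assoc, Unitary.coe_star_mul_self, one_mul,
    Matrix.trace_diagonal]

open scoped ComplexOrder in
/-- The trace norm is attained in the dual formula. -/
lemma exists_trace_mul_eq_traceNorm (A : Mat d) :
    ∃ W : Mat d, ‖W‖ ≤ 1 ∧ (W * A).trace = (traceNorm A : ℂ) := by
  set hA := Matrix.isHermitian_conjTranspose_mul_self A with hAdef
  set U := hA.eigenvectorUnitary with hU
  have hnn : ∀ i, 0 ≤ hA.eigenvalues i := fun i =>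
    (Matrix.posSemidef_conjTranspose_mul_self A).eigenvalues_nonneg i
  -- `H` is the pseudo-inverse of `|A|`, since `0⁻¹ = 0` handles the kernel. The witness `H Aᴴ` is
  -- the adjoint of the partial isometry in the polar decomposition of `A`.
  set g : Fin d → ℂ := fun i => ((√(hA.eigenvalues i))⁻¹ : ℝ) with hg
  set H : Mat d := (U : Mat d) * Matrix.diagonal g * star (U : Mat d) with hH
  have hHstar : star H = H := by
    simp only [hH, star_mul, mul_assoc, Matrix.star_eq_conjTranspose,
      Matrix.conjTranspose_conjTranspose,
      Matrix.diagonal_conjTranspose]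
    congr 3
    ext i
    exact Complex.conj_ofReal _
  have hspec := spectral_decomposition hA
  have hsq : ∀ i, (hA.eigenvalues i : ℝ) = √(hA.eigenvalues i) * √(hA.eigenvalues i) :=
    fun i => (Real.mul_self_sqrt (hnn i)).symm
  refine ⟨H * star A, ?_, ?_⟩
  · have h1 : ‖H * star A‖ * ‖H * star A‖ ≤ 1 := by
      rw [← CStarRing.norm_self_mul_star, star_mul, star_star, hHstar]
      have : H * star A * (A * H) = H * (Aᴴ * A) * H := by
        simp only [mul_assoc, Matrix.star_eq_conjTranspose]
      rw [this, hspec, hH, unitary_conj_diagonal_mul, unitary_conj_diagonal_mul,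
        norm_unitary_conj_diagonal]
      refine (pi_norm_le_iff_of_nonneg zero_le_one).2 fun i => ?_
      simp only [hg, ← Complex.ofReal_mul, Complex.norm_real, Real.norm_eq_abs]
      rw [abs_le_one_iff_mul_self_le_one]
      by_cases h0 : √(hA.eigenvalues i) = 0
      · simp [h0]
      · have : (√(hA.eigenvalues i))⁻¹ * hA.eigenvalues i * (√(hA.eigenvalues i))⁻¹ = 1 := by
          rw [hsq i, Real.sqrt_mul_self (Real.sqrt_nonneg _)]
          field_simp
        simp [this]
    nlinarith [norm_nonneg (H * star A)]
  · have : H * star A * A = H * (Aᴴ * A) := by rw [mul_assoc, Matrix.star_eq_conjTranspose]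
    rw [this, hspec, hH, unitary_conj_diagonal_mul, trace_unitary_conj_diagonal, traceNorm]
    push_cast
    refine Finset.sum_congr rfl fun i _ => ?_
    simp only [hg, ← Complex.ofReal_mul]
    congr 1
    by_cases h0 : √(hA.eigenvalues i) = 0
    · simp [h0]
    · rw [hsq i, Real.sqrt_mul_self (Real.sqrt_nonneg _)]
      field_simp

/-- Subadditivity is not visible from singular values; this variational form turns it, and the other
norm inequalities, into statements about a linear functional. -/
lemma traceNorm_le_of_forall {A : Mat d} {c : ℝ}
    (h : ∀ W : Mat d, ‖W‖ ≤ 1 → ‖(W * A).trace‖ ≤ c) : traceNorm A ≤ c := by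
  obtain ⟨W, hW, hWA⟩ := exists_trace_mul_eq_traceNorm A
  have := h W hW
  rwa [hWA, Complex.norm_real, Real.norm_of_nonneg (traceNorm_nonneg A)] at this

lemma norm_trace_mul_le_traceNorm {W A : Mat d} (hW : ‖W‖ ≤ 1) :
    ‖(W * A).trace‖ ≤ traceNorm A :=
  (norm_trace_mul_le W A).trans (mul_le_of_le_one_left (traceNorm_nonneg A) hW)

lemma traceNorm_add_le (A B : Mat d) : traceNorm (A + B) ≤ traceNorm A + traceNorm B := by
  refine traceNorm_le_of_forall fun W hW => ?_
  rw [mul_add, Matrix.trace_add]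
  exact (norm_add_le _ _).trans
    (add_le_add (norm_trace_mul_le_traceNorm hW) (norm_trace_mul_le_traceNorm hW))

lemma traceNorm_smul_le (c : ℂ) (A : Mat d) : traceNorm (c • A) ≤ ‖c‖ * traceNorm A := by
  refine traceNorm_le_of_forall fun W hW => ?_
  rw [mul_smul_comm, Matrix.trace_smul, norm_smul]
  exact mul_le_mul_of_nonneg_left (norm_trace_mul_le_traceNorm hW) (norm_nonneg c)

lemma traceNorm_neg (A : Mat d) : traceNorm (-A) = traceNorm A := by
  have h : ∀ B : Mat d, traceNorm (-B) ≤ traceNorm B := fun B => by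
    simpa using traceNorm_smul_le (-1) B
  exact le_antisymm (h A) (by simpa using h (-A))

lemma traceNorm_sub_le (A B : Mat d) : traceNorm (A - B) ≤ traceNorm A + traceNorm B := by
  simpa [sub_eq_add_neg, traceNorm_neg] using traceNorm_add_le A (-B)

lemma traceNorm_zero : traceNorm (0 : Mat d) = 0 :=
  le_antisymm (by simpa using traceNorm_smul_le (0 : ℂ) (0 : Mat d)) (traceNorm_nonneg _)

lemma traceNorm_conjTranspose_le (A : Mat d) : traceNorm Aᴴ ≤ traceNorm A := by
  refine traceNorm_le_of_forall fun W hW => ?_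
  have h : (W * Aᴴ).trace = star (Wᴴ * A).trace := by
    rw [← Matrix.trace_conjTranspose, Matrix.conjTranspose_mul, Matrix.conjTranspose_conjTranspose,
      Matrix.trace_mul_comm]
  rw [h, norm_star]
  exact norm_trace_mul_le_traceNorm (by rwa [Matrix.l2_opNorm_conjTranspose])

lemma norm_trace_le_traceNorm (A : Mat d) : ‖A.trace‖ ≤ traceNorm A := by
  rcases isEmpty_or_nonempty (Fin d) with h | h
  · simpa [Matrix.trace] using traceNorm_nonneg A
  · simpa using norm_trace_mul_le_traceNorm (W := 1) (A := A) CStarRing.norm_one.le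

lemma norm_apply_le_traceNorm (A : Mat d) (i j : Fin d) : ‖A i j‖ ≤ traceNorm A := by
  have h1 : ‖(Matrix.single j i 1 : Mat d)‖ ≤ 1 := by
    have h2 : ‖(Matrix.single j i 1 : Mat d)‖ * ‖(Matrix.single j i 1 : Mat d)‖ ≤ 1 := by
      rw [← Matrix.l2_opNorm_conjTranspose_mul_self, Matrix.conjTranspose_single,
        Matrix.single_mul_single_same, star_one, one_mul, ← Matrix.diagonal_single,
        Matrix.l2_opNorm_diagonal]
      refine (pi_norm_le_iff_of_nonneg zero_le_one).2 fun k => ?_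
      by_cases hk : k = i
      · subst hk; simp
      · simp [hk]
    nlinarith [norm_nonneg (Matrix.single j i 1 : Mat d)]
  have := norm_trace_mul_le_traceNorm (A := A) h1
  rwa [Matrix.trace_single_mul, one_smul] at this

lemma traceNorm_eq_zero {A : Mat d} : traceNorm A = 0 ↔ A = 0 := by
  refine ⟨fun h => ?_, fun h => h ▸ traceNorm_zero⟩
  ext i j
  exact norm_le_zero_iff.1 ((norm_apply_le_traceNorm A i j).trans h.le)

lemma traceNorm_pos {A : Mat d} (hA : A ≠ 0) : 0 < traceNorm A :=
  lt_of_le_of_ne (traceNorm_nonneg A) fun h => hA (traceNorm_eq_zero.1 h.symm)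

-- In an eigenbasis of `P` the columns have lengths equal to the nonnegative eigenvalues, which sum
-- to the trace.
open scoped ComplexOrder in
lemma traceNorm_le_trace {P : Mat d} (hP : P.PosSemidef) : traceNorm P ≤ P.trace.re := by
  refine traceNorm_le_of_forall fun W hW => ?_
  refine (norm_trace_mul_le_sum W P hP.1.eigenvectorBasis).trans ?_
  have h : P.trace.re = ∑ i, hP.1.eigenvalues i := by
    rw [hP.1.trace_eq_sum_eigenvalues]
    simp
  rw [h]
  simp only [norm_toEuclideanCLM_eigenvectorBasis, abs_of_nonneg (hP.eigenvalues_nonneg _)]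
  exact mul_le_of_le_one_left (Finset.sum_nonneg fun i _ => hP.eigenvalues_nonneg i) hW

open scoped ComplexOrder in
/-- Jordan decomposition of a Hermitian matrix. -/
lemma exists_posSemidef_sub {A : Mat d} (hA : A.IsHermitian) :
    ∃ P N : Mat d, P.PosSemidef ∧ N.PosSemidef ∧ A = P - N ∧
      P.trace.re + N.trace.re ≤ traceNorm A := by
  set U := hA.eigenvectorUnitary with hU
  have hpos : ∀ f : Fin d → ℝ, (∀ i, 0 ≤ f i) →
      ((U : Mat d) * Matrix.diagonal (fun i => (f i : ℂ)) * star (U : Mat d)).PosSemidef := by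
    intro f hf
    rw [Matrix.star_eq_conjTranspose]
    refine Matrix.PosSemidef.mul_mul_conjTranspose_same (Matrix.PosSemidef.diagonal ?_) _
    intro i
    simpa using hf i
  refine ⟨_, _, hpos (fun i => max (hA.eigenvalues i) 0) (fun i => le_max_right _ _),
    hpos (fun i => max (-hA.eigenvalues i) 0) (fun i => le_max_right _ _), ?_, ?_⟩
  · conv_lhs => rw [spectral_decomposition hA]
    rw [← sub_mul, ← mul_sub, Matrix.diagonal_sub]
    congr 3
    ext i
    rw [← Complex.ofReal_sub]
    congr 1
    rcases le_total 0 (hA.eigenvalues i) with h | h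
    · rw [max_eq_left h, max_eq_right (by linarith)]; ring
    · rw [max_eq_right h, max_eq_left (by linarith)]; ring
  · rw [trace_unitary_conj_diagonal, trace_unitary_conj_diagonal]
    -- Pairing `A` with its own sign matrix, which has norm at most 1, gives `∑ |λ i|`, the sum of
    -- the two traces.
    set s : Fin d → ℂ := fun i => (if 0 ≤ hA.eigenvalues i then 1 else -1 : ℝ) with hs
    have hW : ‖(U : Mat d) * Matrix.diagonal s * star (U : Mat d)‖ ≤ 1 := by
      rw [norm_unitary_conj_diagonal]
      refine (pi_norm_le_iff_of_nonneg zero_le_one).2 fun i => ?_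
      simp only [hs, Complex.norm_real, Real.norm_eq_abs]
      split_ifs <;> simp
    have := norm_trace_mul_le_traceNorm (A := A) hW
    refine le_trans (le_trans ?_ (Complex.re_le_norm _)) this
    conv_rhs => rw [spectral_decomposition hA]
    rw [unitary_conj_diagonal_mul, trace_unitary_conj_diagonal]
    simp only [hs, ← Complex.ofReal_mul, ← Complex.ofReal_sum, Complex.ofReal_re]
    rw [← Finset.sum_add_distrib]
    refine Finset.sum_le_sum fun i _ => ?_
    split_ifs with h
    · rw [max_eq_left h, max_eq_right (by linarith)]; linarith
    · rw [max_eq_right (by linarith), max_eq_left (by linarith)]; linarith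

end TraceNorm

/-! ### Positive trace-preserving maps and their contraction coefficients -/

section Superoperators

open scoped Matrix

variable {d : ℕ}

/-- Positive trace-preserving maps. -/
structure IsPTP (T : Superop d) : Prop where
  posSemidef : open scoped ComplexOrder in ∀ P : Mat d, P.PosSemidef → (T P).PosSemidef
  trace : ∀ X, (T X).trace = X.trace

open scoped ComplexOrder Matrix.Norms.L2Operator MatrixOrder CStarAlgebra in
lemma IsCPTP.isPTP {T : Superop d} (hT : IsCPTP T) : IsPTP T := by
  obtain ⟨⟨φ, rfl⟩, htr⟩ := hT
  refine ⟨fun _ hP => ?_, htr⟩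
  have h := map_nonneg φ (Matrix.nonneg_iff_posSemidef.2 hP)
  exact Matrix.nonneg_iff_posSemidef.1 h

lemma IsPTP.id : IsPTP (LinearMap.id : Superop d) := ⟨fun _ h => h, fun _ => rfl⟩

lemma IsPTP.comp {T S : Superop d} (hT : IsPTP T) (hS : IsPTP S) : IsPTP (T ∘ₗ S) :=
  ⟨fun _ hP => hT.posSemidef _ (hS.posSemidef _ hP), fun X => (hT.trace _).trans (hS.trace X)⟩

lemma IsPTP.isState {T : Superop d} (hT : IsPTP T) {ρ : Mat d} (hρ : IsState ρ) :
    IsState (T ρ) :=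
  ⟨hT.posSemidef _ hρ.1, (hT.trace ρ).trans hρ.2⟩

lemma IsPTP.isHermitian {T : Superop d} (hT : IsPTP T) {X : Mat d} (hX : X.IsHermitian) :
    (T X).IsHermitian := by
  obtain ⟨P, N, hP, hN, rfl, -⟩ := exists_posSemidef_sub hX
  rw [map_sub]
  exact (hT.posSemidef _ hP).1.sub (hT.posSemidef _ hN).1

/-- Positive trace-preserving maps contract the trace norm of Hermitian matrices. -/
lemma IsPTP.traceNorm_le {T : Superop d} (hT : IsPTP T) {X : Mat d} (hX : X.IsHermitian) :
    traceNorm (T X) ≤ traceNorm X := by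
  obtain ⟨P, N, hP, hN, hPN, hle⟩ := exists_posSemidef_sub hX
  refine le_trans ?_ hle
  rw [hPN, map_sub]
  refine (traceNorm_sub_le _ _).trans (add_le_add ?_ ?_)
  · rw [← hT.trace P]; exact traceNorm_le_trace (hT.posSemidef _ hP)
  · rw [← hT.trace N]; exact traceNorm_le_trace (hT.posSemidef _ hN)

/-- Every superoperator is bounded for the trace norm. -/
lemma exists_traceNorm_map_le (T : Superop d) :
    ∃ c, ∀ X, traceNorm (T X) ≤ c * traceNorm X := by
  have hsum : ∀ (s : Finset (Fin d × Fin d)) (f : Fin d × Fin d → Mat d),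
      traceNorm (∑ i ∈ s, f i) ≤ ∑ i ∈ s, traceNorm (f i) := by
    classical
    intro s f
    induction s using Finset.induction_on with
    | empty => simp [traceNorm_zero]
    | insert a s ha ih =>
      rw [Finset.sum_insert ha, Finset.sum_insert ha]
      exact (traceNorm_add_le _ _).trans (by gcongr)
  refine ⟨∑ p : Fin d × Fin d, traceNorm (T (Matrix.single p.1 p.2 1)), fun X => ?_⟩
  have hX : X = ∑ p : Fin d × Fin d, X p.1 p.2 • (Matrix.single p.1 p.2 1 : Mat d) := by
    conv_lhs => rw [Matrix.matrix_eq_sum_single X]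
    rw [Fintype.sum_prod_type]
    simp
  conv_lhs => rw [hX, map_sum]
  refine (hsum _ _).trans ?_
  rw [Finset.sum_mul]
  refine Finset.sum_le_sum fun p _ => ?_
  rw [map_smul, mul_comm]
  exact (traceNorm_smul_le _ _).trans
    (mul_le_mul_of_nonneg_right (norm_apply_le_traceNorm _ _ _) (traceNorm_nonneg _))

/-- The norm of a superoperator induced by the trace norm on a class of test matrices. -/
noncomputable def normOn (p : Mat d → Prop) (T : Superop d) : ℝ :=
  sSup {r : ℝ | ∃ X : Mat d, (p X ∧ X ≠ 0) ∧ r = traceNorm (T X) / traceNorm X}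

lemma oneOneNorm_eq (T : Superop d) : oneOneNorm T = normOn (fun _ => True) T := by
  simp [oneOneNorm, normOn]

lemma kappaTr_eq (T : Superop d) :
    kappaTr T = normOn (fun X => X.IsHermitian ∧ X.trace = 0) T := by
  simp only [kappaTr, normOn, and_assoc]

variable {p : Mat d → Prop}

lemma normOn_nonneg (T : Superop d) : 0 ≤ normOn p T := by
  refine Real.sSup_nonneg ?_
  rintro _ ⟨X, -, rfl⟩
  exact div_nonneg (traceNorm_nonneg _) (traceNorm_nonneg _)

/-- A real `sSup` dominates its set only when the set is bounded above; `exists_traceNorm_map_le`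
supplies the bound. -/
lemma traceNorm_map_le_normOn (T : Superop d) {X : Mat d} (hX : p X) :
    traceNorm (T X) ≤ normOn p T * traceNorm X := by
  rcases eq_or_ne X 0 with rfl | h0
  · simp [traceNorm_zero]
  rw [← div_le_iff₀ (traceNorm_pos h0)]
  obtain ⟨c, hc⟩ := exists_traceNorm_map_le T
  refine le_csSup ⟨c, ?_⟩ ⟨X, ⟨hX, h0⟩, rfl⟩
  rintro _ ⟨Y, ⟨-, hY⟩, rfl⟩
  exact (div_le_iff₀ (traceNorm_pos hY)).2 (hc Y)

lemma normOn_le {T : Superop d} {c : ℝ} (hc : 0 ≤ c)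
    (h : ∀ X, p X → traceNorm (T X) ≤ c * traceNorm X) : normOn p T ≤ c := by
  refine Real.sSup_le ?_ hc
  rintro _ ⟨X, ⟨hp, h0⟩, rfl⟩
  exact (div_le_iff₀ (traceNorm_pos h0)).2 (h X hp)

lemma normOn_add_le (T S : Superop d) : normOn p (T + S) ≤ normOn p T + normOn p S := by
  refine normOn_le (add_nonneg (normOn_nonneg _) (normOn_nonneg _)) fun X hX => ?_
  rw [add_mul, LinearMap.add_apply]
  exact (traceNorm_add_le _ _).trans
    (add_le_add (traceNorm_map_le_normOn T hX) (traceNorm_map_le_normOn S hX))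

lemma normOn_smul_le {c : ℝ} (hc : 0 ≤ c) (T : Superop d) :
    normOn p (c • T) ≤ c * normOn p T := by
  refine normOn_le (mul_nonneg hc (normOn_nonneg _)) fun X hX => ?_
  have h : (c • T) X = (c : ℂ) • T X := by
    rw [LinearMap.smul_apply]
    exact (Complex.coe_smul c (T X)).symm
  rw [h]
  refine (traceNorm_smul_le _ _).trans ?_
  rw [Complex.norm_real, Real.norm_of_nonneg hc, mul_assoc]
  exact mul_le_mul_of_nonneg_left (traceNorm_map_le_normOn T hX) hc

/-! ### Measurability of superoperator norms and of compositions -/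

lemma measurable_superop_iff {α : Type*} {m : MeasurableSpace α} {f : α → Superop d} :
    Measurable f ↔ ∀ X i j, Measurable fun a => f a X i j := by
  constructor
  · intro hf X i j
    have : Measurable fun T : Superop d => T X i j := by
      rw [measurable_iff_comap_le]
      exact le_iSup_of_le X (le_iSup_of_le i (le_iSup_of_le j le_rfl))
    exact this.comp hf
  · intro h
    rw [measurable_iff_le_map]
    refine iSup_le fun X => iSup_le fun i => iSup_le fun j => ?_
    rw [MeasurableSpace.comap_le_iff_le_map]
    exact measurable_iff_le_map.1 (h X i j)

/-- The superoperator with prescribed values on matrix units. -/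
noncomputable def ofEntries (d : ℕ) : (Fin d → Fin d → Fin d → Fin d → ℂ) →ₗ[ℝ] Superop d where
  toFun v := ∑ i, ∑ j, (Matrix.entryLinearMap ℂ ℂ i j).smulRight (Matrix.of (v i j) : Mat d)
  map_add' v w := by
    rw [← Finset.sum_add_distrib]
    refine Finset.sum_congr rfl fun i _ => ?_
    rw [← Finset.sum_add_distrib]
    refine Finset.sum_congr rfl fun j _ => ?_
    ext : 2
    simp [← Matrix.of_add_of, mul_add]
  map_smul' c v := by
    rw [Finset.smul_sum]
    refine Finset.sum_congr rfl fun i _ => ?_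
    rw [Finset.smul_sum]
    refine Finset.sum_congr rfl fun j _ => ?_
    apply LinearMap.ext
    intro X
    ext k l
    simp [mul_left_comm]

lemma ofEntries_apply (T : Superop d) :
    ofEntries d (fun i j k l => T (Matrix.single i j 1) k l) = T := by
  apply LinearMap.ext
  intro X
  conv_rhs => rw [Matrix.matrix_eq_sum_single X]
  simp only [ofEntries, LinearMap.coe_mk, AddHom.coe_mk, LinearMap.sum_apply, map_sum]
  refine Finset.sum_congr rfl fun i _ => Finset.sum_congr rfl fun j _ => ?_
  have : (Matrix.single i j (X i j) : Mat d) = X i j • Matrix.single i j 1 := by simp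
  rw [this, map_smul]
  rfl

/-- A seminorm is convex, hence continuous in the finitely many entries, and these entries are
measurable by construction of the σ-algebra. -/
lemma measurable_normOn : Measurable (normOn p : Superop d → ℝ) := by
  have hconv : ConvexOn ℝ Set.univ fun v => normOn p (ofEntries d v) := by
    refine ⟨convex_univ, fun x _ y _ a b ha hb _ => ?_⟩
    simp only [map_add, map_smul, smul_eq_mul]
    exact (normOn_add_le _ _).trans (add_le_add (normOn_smul_le ha _) (normOn_smul_le hb _))
  have hcont : Continuous fun v => normOn p (ofEntries d v) :=
    continuousOn_univ.1 (hconv.continuousOn isOpen_univ)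
  have hent : Measurable fun (T : Superop d) i j k l => T (Matrix.single i j 1) k l := by
    refine measurable_pi_lambda _ fun i => measurable_pi_lambda _ fun j =>
      measurable_pi_lambda _ fun k => measurable_pi_lambda _ fun l => ?_
    exact measurable_superop_iff.1 measurable_id _ k l
  have : BorelSpace (Fin d → Fin d → ℂ) := Pi.borelSpace
  have : BorelSpace (Fin d → Fin d → Fin d → ℂ) := Pi.borelSpace
  have : BorelSpace (Fin d → Fin d → Fin d → Fin d → ℂ) := Pi.borelSpace
  have := hcont.measurable.comp hent
  simpa only [Function.comp_def, ofEntries_apply] using this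

lemma measurable_oneOneNorm : Measurable (oneOneNorm : Superop d → ℝ) := by
  have : (oneOneNorm : Superop d → ℝ) = normOn fun _ => True := funext oneOneNorm_eq
  rw [this]
  exact measurable_normOn

lemma measurable_kappaTr : Measurable (kappaTr : Superop d → ℝ) := by
  have : (kappaTr : Superop d → ℝ) = normOn _ := funext kappaTr_eq
  rw [this]
  exact measurable_normOn

lemma superop_apply_apply (T : Superop d) (A : Mat d) (i j : Fin d) :
    T A i j = ∑ k, ∑ l, A k l * T (Matrix.single k l 1) i j := by
  conv_lhs => rw [Matrix.matrix_eq_sum_single A]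
  simp only [map_sum, Matrix.sum_apply]
  refine Finset.sum_congr rfl fun k _ => Finset.sum_congr rfl fun l _ => ?_
  have : (Matrix.single k l (A k l) : Mat d) = A k l • Matrix.single k l 1 := by simp
  rw [this, map_smul]
  rfl

lemma measurable_superop_comp {α : Type*} {m : MeasurableSpace α} {f g : α → Superop d}
    (hf : Measurable f) (hg : Measurable g) : Measurable fun a => f a ∘ₗ g a := by
  rw [measurable_superop_iff] at hf hg ⊢
  intro X i j
  simp only [LinearMap.comp_apply, superop_apply_apply (f _) (g _ X)]
  exact Finset.measurable_sum _ fun k _ => Finset.measurable_sum _ fun l _ =>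
    (hg X k l).mul (hf _ i j)

lemma kappaTr_nonneg (T : Superop d) : 0 ≤ kappaTr T := by
  rw [kappaTr_eq]; exact normOn_nonneg T

lemma traceNorm_map_le_kappaTr (T : Superop d) {X : Mat d} (hX : X.IsHermitian)
    (hX0 : X.trace = 0) : traceNorm (T X) ≤ kappaTr T * traceNorm X := by
  rw [kappaTr_eq]
  exact traceNorm_map_le_normOn (p := fun X => X.IsHermitian ∧ X.trace = 0) T ⟨hX, hX0⟩

/-- `S` keeps test matrices Hermitian and traceless, so `S X` is again a test matrix for `T`. -/
lemma kappaTr_comp_le (T : Superop d) {S : Superop d} (hS : IsPTP S) :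
    kappaTr (T ∘ₗ S) ≤ kappaTr T * kappaTr S := by
  rw [kappaTr_eq (T ∘ₗ S)]
  refine normOn_le (mul_nonneg (kappaTr_nonneg _) (kappaTr_nonneg _)) fun X hX => ?_
  refine (traceNorm_map_le_kappaTr T (hS.isHermitian hX.1) ((hS.trace X).trans hX.2)).trans ?_
  rw [mul_assoc]
  exact mul_le_mul_of_nonneg_left (traceNorm_map_le_kappaTr S hX.1 hX.2) (kappaTr_nonneg _)

lemma IsPTP.kappaTr_le_one {T : Superop d} (hT : IsPTP T) : kappaTr T ≤ 1 := by
  rw [kappaTr_eq]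
  refine normOn_le zero_le_one fun X hX => ?_
  rw [one_mul]
  exact hT.traceNorm_le hX.1

/-- On all traceless matrices the contraction coefficient is at most twice the Hermitian one. -/
lemma traceNorm_map_le_two_kappaTr (T : Superop d) {X : Mat d} (hX : X.trace = 0) :
    traceNorm (T X) ≤ 2 * kappaTr T * traceNorm X := by
  have hbound : ∀ Y : Mat d, Y.IsHermitian → Y.trace = 0 → traceNorm Y ≤ 2 * traceNorm X →
      traceNorm (T Y) ≤ kappaTr T * (2 * traceNorm X) := fun Y hY hY0 hle =>
    (traceNorm_map_le_kappaTr T hY hY0).trans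
      (mul_le_mul_of_nonneg_left hle (kappaTr_nonneg _))
  have htr : (Xᴴ).trace = 0 := by rw [Matrix.trace_conjTranspose, hX, star_zero]
  have hsmul : ∀ c : ℂ, ‖c‖ = 1 → ∀ Y : Mat d, traceNorm (c • Y) ≤ traceNorm Y := fun c hc Y => by
    simpa [hc] using traceNorm_smul_le c Y
  have h1 := hbound (X + Xᴴ)
    (by rw [Matrix.IsHermitian, Matrix.conjTranspose_add, Matrix.conjTranspose_conjTranspose,
          add_comm])
    (by rw [Matrix.trace_add, hX, htr, add_zero])
    ((traceNorm_add_le _ _).trans (by linarith [traceNorm_conjTranspose_le X]))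
  have h2 := hbound (Complex.I • (X - Xᴴ))
    (by rw [Matrix.IsHermitian, Matrix.conjTranspose_smul, Matrix.conjTranspose_sub,
          Matrix.conjTranspose_conjTranspose, ← neg_sub X, smul_neg, ← neg_smul]; simp)
    (by rw [Matrix.trace_smul, Matrix.trace_sub, hX, htr, sub_zero, smul_zero])
    ((hsmul _ Complex.norm_I _).trans ((traceNorm_sub_le _ _).trans
      (by linarith [traceNorm_conjTranspose_le X])))
  -- Cartesian decomposition: both Hermitian pieces have trace norm at most `2 ‖X‖`, so the constant
  -- is `(2 + 2) / 2`.
  have hdec : T X = (1 / 2 : ℂ) • (T (X + Xᴴ) + (-Complex.I) • T (Complex.I • (X - Xᴴ))) := by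
    rw [← map_smul, ← map_add, ← map_smul]
    congr 1
    rw [smul_smul, neg_mul, Complex.I_mul_I, neg_neg, one_smul, add_add_sub_cancel, ← two_smul ℂ X,
      smul_smul]
    norm_num
  rw [hdec]
  refine (traceNorm_smul_le _ _).trans ?_
  have h3 := (traceNorm_add_le (T (X + Xᴴ)) ((-Complex.I) • T (Complex.I • (X - Xᴴ)))).trans
    (add_le_add h1 ((hsmul _ (by simp) _).trans h2))
  have h4 : ‖(1 / 2 : ℂ)‖ = 1 / 2 := by norm_num
  rw [h4]
  linarith

open scoped ComplexOrder in
lemma IsState.traceNorm_le_one {ρ : Mat d} (hρ : IsState ρ) : traceNorm ρ ≤ 1 := by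
  simpa [hρ.2] using traceNorm_le_trace hρ.1

lemma traceNorm_map_sub_le_of_isState (T : Superop d) {ρ σ : Mat d} (hρ : IsState ρ)
    (hσ : IsState σ) : traceNorm (T ρ - T σ) ≤ 2 * kappaTr T := by
  rw [← map_sub]
  refine (traceNorm_map_le_kappaTr T (hρ.1.1.sub hσ.1.1)
    (by rw [Matrix.trace_sub, hρ.2, hσ.2, sub_self])).trans ?_
  have := (traceNorm_sub_le ρ σ).trans (add_le_add hρ.traceNorm_le_one hσ.traceNorm_le_one)
  nlinarith [kappaTr_nonneg T]

/-- A channel is close to the replacement map of the image of any state. -/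
lemma oneOneNorm_sub_replacement_le (T : Superop d) {ρ : Mat d} (hρ : IsState ρ) :
    oneOneNorm (T - replacement (T ρ)) ≤ 4 * kappaTr T := by
  rw [oneOneNorm_eq]
  refine normOn_le (mul_nonneg (by norm_num) (kappaTr_nonneg _)) fun X _ => ?_
  have h : (T - replacement (T ρ)) X = T (X - X.trace • ρ) := by
    rw [map_sub, map_smul]
    rfl
  rw [h]
  refine (traceNorm_map_le_two_kappaTr T
    (by rw [Matrix.trace_sub, Matrix.trace_smul, hρ.2]; simp)).trans ?_
  -- This 2 from centering and the 2 from non-Hermitian `X` make the constant 4.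
  have h2 : traceNorm (X - X.trace • ρ) ≤ 2 * traceNorm X := by
    refine (traceNorm_sub_le _ _).trans ?_
    have := (traceNorm_smul_le X.trace ρ).trans
      (mul_le_mul (norm_trace_le_traceNorm X) hρ.traceNorm_le_one (traceNorm_nonneg _)
        (traceNorm_nonneg _))
    linarith
  nlinarith [kappaTr_nonneg T]

lemma oneOneNorm_nonneg (T : Superop d) : 0 ≤ oneOneNorm T := by
  rw [oneOneNorm_eq]; exact normOn_nonneg T

open scoped ComplexOrder in
lemma exists_isState (hd : 0 < d) : ∃ ρ : Mat d, IsState ρ := by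
  refine ⟨Matrix.diagonal (Pi.single ⟨0, hd⟩ 1), Matrix.PosSemidef.diagonal ?_, ?_⟩
  · intro i
    by_cases h : i = ⟨0, hd⟩
    · subst h; simp
    · simp [h]
  · simp [Matrix.trace_diagonal]

open scoped ComplexOrder in
/-- Entrywise limits of states are states. -/
lemma isState_of_tendsto {ρ : ℕ → Mat d} {σ : Mat d} (hρ : ∀ n, IsState (ρ n))
    (h : ∀ i j, Tendsto (fun n => ρ n i j) atTop (𝓝 (σ i j))) : IsState σ := by
  refine ⟨Matrix.PosSemidef.of_dotProduct_mulVec_nonneg ?_ fun x => ?_, ?_⟩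
  · ext i j
    refine tendsto_nhds_unique ?_ (h i j)
    have := (continuous_star.tendsto _).comp (h j i)
    refine this.congr fun n => ?_
    exact (hρ n).1.1.apply i j
  · refine ge_of_tendsto' (f := fun n => star x ⬝ᵥ (ρ n *ᵥ x)) (x := atTop) ?_
      fun n => (hρ n).1.dotProduct_mulVec_nonneg x
    simp only [dotProduct, Matrix.mulVec]
    exact tendsto_finsetSum _ fun i _ => (tendsto_finsetSum _ fun j _ =>
      (h i j).mul_const _).const_mul _
  · refine tendsto_nhds_unique (tendsto_finsetSum _ fun i _ => h i i) ?_
    exact tendsto_const_nhds.congr fun n => ((hρ n).2).symm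

end Superoperators

/-! ### Shifts, products of channels and contraction along orbits -/

section CocycleLemmas

variable {Ω : Type*} {mΩ : MeasurableSpace Ω} {d : ℕ} {μ : Measure Ω}
  {θ : Ω ≃ᵐ Ω} {Φ : Ω → Superop d}

lemma shift_zero (ω : Ω) : shift θ 0 ω = ω := by simp [shift]

lemma shift_add (a b : ℤ) (ω : Ω) : shift θ (a + b) ω = shift θ a (shift θ b ω) := by
  simp [shift, zpow_add]

lemma shift_one (ω : Ω) : shift θ 1 ω = θ ω := by simp [shift]

lemma shift_neg_one (ω : Ω) : shift θ (-1) ω = θ.symm ω := by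
  simp [shift]

lemma measurePreserving_shift (hθ : MeasurePreserving θ μ μ) (j : ℤ) :
    MeasurePreserving (shift θ j) μ μ := by
  induction j using Int.induction_on with
  | zero =>
    have : shift θ 0 = id := funext shift_zero
    rw [this]
    exact MeasurePreserving.id μ
  | succ n ih =>
    have : shift θ (n + 1) = shift θ n ∘ θ := funext fun ω => by
      rw [shift_add, shift_one, Function.comp_apply]
    rw [this]
    exact ih.comp hθ
  | pred n ih =>
    have : shift θ (-n - 1) = shift θ (-n) ∘ θ.symm := funext fun ω => by
      rw [sub_eq_add_neg, shift_add, shift_neg_one, Function.comp_apply]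
    rw [this]
    exact ih.comp (hθ.symm θ)

lemma channelAt_shift (j k : ℤ) (ω : Ω) :
    channelAt θ Φ j (shift θ k ω) = channelAt θ Φ (j + k) ω := by
  rw [channelAt, channelAt, shift_add]

lemma channelProd_shift (s k : ℤ) (n : ℕ) (ω : Ω) :
    channelProd θ Φ (shift θ k ω) s n = channelProd θ Φ ω (s + k) n := by
  induction n with
  | zero => rfl
  | succ n ih =>
    rw [channelProd, channelProd, ih, channelAt_shift]
    congr 2
    ring

lemma channelProd_add (s : ℤ) (m n : ℕ) (ω : Ω) :
    channelProd θ Φ ω s (m + n) = channelProd θ Φ ω (s + m) n ∘ₗ channelProd θ Φ ω s m := by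
  induction n with
  | zero => rfl
  | succ n ih =>
    rw [← add_assoc, channelProd, ih, channelProd, LinearMap.comp_assoc]
    congr 2
    push_cast
    ring

lemma isPTP_channelProd (hΦ : ∀ ω, IsPTP (Φ ω)) (s : ℤ) (n : ℕ) (ω : Ω) :
    IsPTP (channelProd θ Φ ω s n) := by
  induction n with
  | zero => exact IsPTP.id
  | succ n ih => exact (hΦ _).comp ih

lemma propagator_zero_right (n : ℕ) (ω : Ω) :
    propagator θ Φ ω n 0 = channelProd θ Φ ω 0 n := by simp [propagator]

lemma propagator_zero_left (n : ℕ) (ω : Ω) :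
    propagator θ Φ ω 0 (-n) = channelProd θ Φ ω (-n) n := by simp [propagator]

lemma measurable_channelAt (hθ : MeasurePreserving θ μ μ) (hΦ : Measurable Φ) (j : ℤ) :
    Measurable (channelAt θ Φ j) :=
  hΦ.comp (measurePreserving_shift hθ j).measurable

lemma measurable_channelProd_of {α : Type*} {m : MeasurableSpace α} {x : α → Ω} (s : ℤ) (n : ℕ)
    (h : ∀ j, s ≤ j → j < s + n → Measurable fun a => channelAt θ Φ j (x a)) :
    Measurable fun a => channelProd θ Φ (x a) s n := by
  induction n with
  | zero => exact measurable_const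
  | succ n ih =>
    exact measurable_superop_comp (h _ (by omega) (by push_cast; omega))
      (ih fun j hj hj' => h j hj (by push_cast; omega))

lemma measurable_channelProd (hθ : MeasurePreserving θ μ μ) (hΦ : Measurable Φ) (s : ℤ) (n : ℕ) :
    Measurable fun ω => channelProd θ Φ ω s n :=
  measurable_channelProd_of s n fun j _ _ => measurable_channelAt hθ hΦ j

/-- The contraction coefficient of the product of `n` channels starting at time `s`. -/
noncomputable def contraction (θ : Ω ≃ᵐ Ω) (Φ : Ω → Superop d) (s : ℤ) (n : ℕ) (ω : Ω) : ℝ :=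
  kappaTr (channelProd θ Φ ω s n)

lemma contraction_nonneg (s : ℤ) (n : ℕ) (ω : Ω) : 0 ≤ contraction θ Φ s n ω :=
  kappaTr_nonneg _

lemma contraction_le_one (hΦ : ∀ ω, IsPTP (Φ ω)) (s : ℤ) (n : ℕ) (ω : Ω) :
    contraction θ Φ s n ω ≤ 1 :=
  (isPTP_channelProd hΦ s n ω).kappaTr_le_one

lemma contraction_add_le (hΦ : ∀ ω, IsPTP (Φ ω)) (s : ℤ) (m n : ℕ) (ω : Ω) :
    contraction θ Φ s (m + n) ω ≤ contraction θ Φ (s + m) n ω * contraction θ Φ s m ω := by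
  rw [contraction, channelProd_add]
  exact kappaTr_comp_le _ (isPTP_channelProd hΦ s m ω)

lemma contraction_shift (s k : ℤ) (n : ℕ) (ω : Ω) :
    contraction θ Φ s n (shift θ k ω) = contraction θ Φ (s + k) n ω := by
  rw [contraction, channelProd_shift, contraction]

lemma antitone_contraction (hΦ : ∀ ω, IsPTP (Φ ω)) (s : ℤ) (ω : Ω) :
    Antitone fun n => contraction θ Φ s n ω := by
  refine antitone_nat_of_succ_le fun n => (contraction_add_le hΦ s n 1 ω).trans ?_
  exact mul_le_of_le_one_left (contraction_nonneg _ _ _) (contraction_le_one hΦ _ _ _)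

/-- Here the product grows at its past end: the new channel is applied first, and its coefficient is
at most 1. -/
lemma antitone_contraction_pullback (hΦ : ∀ ω, IsPTP (Φ ω)) (ω : Ω) :
    Antitone fun n : ℕ => contraction θ Φ (-n) n ω := by
  refine antitone_nat_of_succ_le fun n => ?_
  have h := contraction_add_le (θ := θ) hΦ (-(n + 1 : ℕ)) 1 n ω
  rw [add_comm 1 n, show (-((n + 1 : ℕ) : ℤ)) + (1 : ℕ) = -n by push_cast; ring] at h
  exact h.trans (mul_le_of_le_one_right (contraction_nonneg _ _ _) (contraction_le_one hΦ _ _ _))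

lemma measurable_contraction (hθ : MeasurePreserving θ μ μ) (hΦ : Measurable Φ) (s : ℤ) (n : ℕ) :
    Measurable (contraction θ Φ s n) :=
  measurable_kappaTr.comp (measurable_channelProd hθ hΦ s n)

lemma integrable_of_mem_Icc [IsProbabilityMeasure μ] {f : Ω → ℝ} (hf : Measurable f)
    (h0 : ∀ ω, 0 ≤ f ω) (h1 : ∀ ω, f ω ≤ 1) : Integrable f μ :=
  Integrable.of_bound hf.aestronglyMeasurable 1
    (Eventually.of_forall fun ω => by rw [Real.norm_of_nonneg (h0 ω)]; exact h1 ω)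

lemma integrable_contraction [IsProbabilityMeasure μ] (hθ : MeasurePreserving θ μ μ)
    (hΦm : Measurable Φ) (hΦ : ∀ ω, IsPTP (Φ ω)) (s : ℤ) (n : ℕ) :
    Integrable (contraction θ Φ s n) μ :=
  integrable_of_mem_Icc (measurable_contraction hθ hΦm s n) (contraction_nonneg s n)
    (contraction_le_one hΦ s n)

lemma integral_contraction (hθ : MeasurePreserving θ μ μ) (hΦ : Measurable Φ) (s : ℤ) (n : ℕ) :
    ∫ ω, contraction θ Φ s n ω ∂μ = ∫ ω, contraction θ Φ 0 n ω ∂μ := by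
  have hs := measurePreserving_shift hθ s
  have h := integral_map (μ := μ) hs.measurable.aemeasurable
    (f := contraction θ Φ 0 n) (measurable_contraction hθ hΦ 0 n).aestronglyMeasurable
  rw [hs.map_eq] at h
  rw [h]
  simp only [contraction_shift, zero_add]

/-! ### Vanishing of the contraction coefficients, almost surely and in mean -/

lemma tendsto_zero_of_antitone {f : ℕ → ℝ} (hf : Antitone f) (h0 : ∀ n, 0 ≤ f n)
    (h : ∀ ε > 0, ∃ n, f n < ε) : Tendsto f atTop (𝓝 0) := by
  rw [Metric.tendsto_atTop]
  intro ε hε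
  obtain ⟨N, hN⟩ := h ε hε
  refine ⟨N, fun n hn => ?_⟩
  rw [Real.dist_eq, sub_zero, abs_of_nonneg (h0 n)]
  exact (hf hn).trans_lt hN

/-- A negative lower exponential rate forces an antitone sequence to vanish in the limit. -/
lemma tendsto_zero_of_liminf_log_neg {f : ℕ → ℝ} (hf : Antitone f) (h0 : ∀ n, 0 ≤ f n)
    (h : liminf (fun n : ℕ => ENNReal.log (ENNReal.ofReal (f n)) / (n : EReal)) atTop < 0) :
    Tendsto f atTop (𝓝 0) := by
  refine tendsto_zero_of_antitone hf h0 fun ε hε => ?_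
  obtain ⟨c, hc, hc0⟩ := EReal.lt_iff_exists_real_btwn.1 h
  have hc0 : c < 0 := by exact_mod_cast hc0
  -- A lower limit gives `log (f n) < c n` only for infinitely many `n`. One such `n` with `c n <
  -- log ε` suffices, because `f` is antitone.
  have hfreq := frequently_lt_of_liminf_lt (by isBoundedDefault) hc
  have hlim : Tendsto (fun n : ℕ => c * n) atTop atBot :=
    tendsto_natCast_atTop_atTop.const_mul_atTop_of_neg hc0
  obtain ⟨n, hn, hn1, hn2⟩ := (hfreq.and_eventually
    ((eventually_ge_atTop 1).and (hlim.eventually_lt_atBot (Real.log ε)))).exists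
  refine ⟨n, lt_of_not_ge fun hle => ?_⟩
  have hnpos : (0 : EReal) < (n : EReal) := by exact_mod_cast hn1
  rw [EReal.div_lt_iff hnpos (EReal.natCast_ne_top n)] at hn
  have h1 : ENNReal.log (ENNReal.ofReal ε) ≤ ENNReal.log (ENNReal.ofReal (f n)) :=
    ENNReal.log_monotone (ENNReal.ofReal_le_ofReal hle)
  rw [ENNReal.log_ofReal_of_pos hε] at h1
  have h2 := h1.trans_lt hn
  have h3 : Real.log ε < c * n := by exact_mod_cast h2
  linarith

lemma ae_tendsto_contraction (hΦ : ∀ ω, IsPTP (Φ ω)) (hlyap : ∀ᵐ ω ∂μ, lyapunovTr θ Φ ω < 0) :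
    ∀ᵐ ω ∂μ, Tendsto (fun n => contraction θ Φ 0 n ω) atTop (𝓝 0) := by
  filter_upwards [hlyap] with ω hω
  refine tendsto_zero_of_liminf_log_neg (antitone_contraction hΦ 0 ω)
    (fun n => contraction_nonneg 0 n ω) ?_
  simpa only [lyapunovTr, propagator_zero_right, contraction] using hω

lemma tendsto_integral_contraction [IsProbabilityMeasure μ] (hθ : MeasurePreserving θ μ μ)
    (hΦm : Measurable Φ) (hΦ : ∀ ω, IsPTP (Φ ω)) (hlyap : ∀ᵐ ω ∂μ, lyapunovTr θ Φ ω < 0) :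
    Tendsto (fun n => ∫ ω, contraction θ Φ 0 n ω ∂μ) atTop (𝓝 0) := by
  have := tendsto_integral_of_dominated_convergence (μ := μ) (F := contraction θ Φ 0)
    (f := fun _ => 0) (fun _ => 1)
    (fun n => (measurable_contraction hθ hΦm 0 n).aestronglyMeasurable) (integrable_const 1)
    (fun n => Eventually.of_forall fun ω => by
      rw [Real.norm_of_nonneg (contraction_nonneg 0 n ω)]; exact contraction_le_one hΦ 0 n ω)
    (ae_tendsto_contraction hΦ hlyap)
  simpa using this

/-- Forward and pullback coefficients over `n` steps have the same mean, which tends to 0. The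
pullback ones are monotone in `n`, so their infimum `l` is their limit; being nonnegative with zero
integral, it vanishes almost surely. -/
lemma ae_tendsto_contraction_pullback [IsProbabilityMeasure μ] (hθ : MeasurePreserving θ μ μ)
    (hΦm : Measurable Φ) (hΦ : ∀ ω, IsPTP (Φ ω)) (hlyap : ∀ᵐ ω ∂μ, lyapunovTr θ Φ ω < 0) :
    ∀ᵐ ω ∂μ, Tendsto (fun n : ℕ => contraction θ Φ (-n) n ω) atTop (𝓝 0) := by
  set l : Ω → ℝ := fun ω => ⨅ n : ℕ, contraction θ Φ (-n) n ω with hl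
  have hbdd : ∀ ω, BddBelow (Set.range fun n : ℕ => contraction θ Φ (-n) n ω) := fun ω =>
    ⟨0, by rintro _ ⟨n, rfl⟩; exact contraction_nonneg _ n ω⟩
  have hlm : Measurable l := Measurable.iInf fun n => measurable_contraction hθ hΦm (-n) n
  have hl0 : ∀ ω, 0 ≤ l ω := fun ω => le_ciInf fun n => contraction_nonneg _ n ω
  have hle : ∀ (n : ℕ) ω, l ω ≤ contraction θ Φ (-n) n ω := fun n ω => ciInf_le (hbdd ω) n
  have hint : Integrable l μ := integrable_of_mem_Icc hlm hl0
    fun ω => (hle 0 ω).trans (contraction_le_one hΦ _ _ ω)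
  have hzero : ∫ ω, l ω ∂μ = 0 := by
    refine le_antisymm (ge_of_tendsto' (tendsto_integral_contraction hθ hΦm hΦ hlyap) fun n => ?_)
      (integral_nonneg hl0)
    rw [← integral_contraction hθ hΦm (-n) n]
    exact integral_mono hint (integrable_contraction hθ hΦm hΦ _ _) (hle n)
  filter_upwards [(integral_eq_zero_iff_of_nonneg hl0 hint).1 hzero] with ω hω
  have := tendsto_atTop_ciInf (antitone_contraction_pullback (θ := θ) hΦ ω) (hbdd ω)
  have h2 : (⨅ n : ℕ, contraction θ Φ (-n) n ω) = 0 := hω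
  rwa [h2] at this

/-! ### Existence and uniqueness of the stationary state -/

lemma ae_shift (hθ : MeasurePreserving θ μ μ) {P : Ω → Prop} (h : ∀ᵐ ω ∂μ, P ω) :
    ∀ᵐ ω ∂μ, ∀ j, P (shift θ j ω) :=
  ae_all_iff.2 fun j => (measurePreserving_shift hθ j).quasiMeasurePreserving.ae h

/-- A stationary state is transported by all products of channels. -/
lemma IsStationaryState.ae_channelProd (hθ : MeasurePreserving θ μ μ) {ρ : Ω → Mat d}
    (hρ : IsStationaryState μ θ Φ ρ) :
    ∀ᵐ ω ∂μ, ∀ s n, channelProd θ Φ ω s n (ρ (shift θ s ω)) = ρ (shift θ (s + n) ω) := by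
  filter_upwards [ae_shift hθ hρ.stationary] with ω hω s n
  induction n with
  | zero => simp [channelProd]
  | succ n ih =>
    rw [channelProd, LinearMap.comp_apply, ih, channelAt, hω, ← shift_one (θ := θ), ← shift_add]
    congr 2
    push_cast
    ring

/-- The orbit of a fixed state started in the past converges almost surely. -/
lemma ae_exists_tendsto_pullback [IsProbabilityMeasure μ] (hθ : MeasurePreserving θ μ μ)
    (hΦm : Measurable Φ) (hΦ : ∀ ω, IsPTP (Φ ω)) (hlyap : ∀ᵐ ω ∂μ, lyapunovTr θ Φ ω < 0)
    {σ : Mat d} (hσ : IsState σ) :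
    ∀ᵐ ω ∂μ, ∃ l : Fin d → Fin d → ℂ, Tendsto
      (fun (n : ℕ) i j => channelProd θ Φ ω (-n) n σ i j) atTop (𝓝 l) := by
  filter_upwards [ae_tendsto_contraction_pullback hθ hΦm hΦ hlyap] with ω hω
  have hentry : ∀ i j, ∃ l : ℂ, Tendsto
      (fun n : ℕ => channelProd θ Φ ω (-n) n σ i j) atTop (𝓝 l) := by
    intro i j
    refine cauchySeq_tendsto_of_complete (cauchySeq_of_le_tendsto_0'
      (fun n : ℕ => 2 * contraction θ Φ (-n) n ω) (fun n m hnm => ?_)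
      (by simpa using hω.const_mul 2))
    obtain ⟨k, rfl⟩ := Nat.exists_eq_add_of_le hnm
    -- Both orbits end with the same `n` channels, applied to two states, so they differ by at most
    -- twice the coefficient of that common block.
    have h : channelProd θ Φ ω (-(n + k : ℕ)) (n + k) σ
        = channelProd θ Φ ω (-n) n (channelProd θ Φ ω (-(n + k : ℕ)) k σ) := by
      rw [add_comm n k, channelProd_add, LinearMap.comp_apply,
        show (-((k + n : ℕ) : ℤ)) + (k : ℕ) = -n by push_cast; ring]
    rw [h, dist_eq_norm, ← Matrix.sub_apply]
    exact (norm_apply_le_traceNorm _ i j).trans (traceNorm_map_sub_le_of_isState _ hσ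
      ((isPTP_channelProd hΦ _ _ _).isState hσ))
  choose l hl using hentry
  exact ⟨l, tendsto_pi_nhds.2 fun i => tendsto_pi_nhds.2 fun j => hl i j⟩

theorem exists_isStationaryState [IsProbabilityMeasure μ] (hd : 0 < d)
    (hθ : MeasurePreserving θ μ μ) (hΦm : Measurable Φ) (hΦ : ∀ ω, IsPTP (Φ ω))
    (hlyap : ∀ᵐ ω ∂μ, lyapunovTr θ Φ ω < 0) : ∃ ρ, IsStationaryState μ θ Φ ρ := by
  obtain ⟨σ, hσ⟩ := exists_isState hd
  have : BorelSpace (Fin d → Fin d → ℂ) := Pi.borelSpace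
  have hmeas : ∀ n : ℕ, Measurable fun ω i j => channelProd θ Φ ω (-n) n σ i j := fun n =>
    measurable_pi_lambda _ fun i => measurable_pi_lambda _ fun j =>
      measurable_superop_iff.1 (measurable_channelProd hθ hΦm (-n) n) σ i j
  obtain ⟨g, hgm, hg⟩ := measurable_limit_of_tendsto_metrizable_ae (μ := μ) (L := atTop)
    (fun n => (hmeas n).aemeasurable) (ae_exists_tendsto_pullback hθ hΦm hΦ hlyap hσ)
  have hgij : ∀ᵐ ω ∂μ, ∀ i j, Tendsto
      (fun n : ℕ => channelProd θ Φ ω (-n) n σ i j) atTop (𝓝 (g ω i j)) := by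
    filter_upwards [hg] with ω hω i j
    exact tendsto_pi_nhds.1 (tendsto_pi_nhds.1 hω i) j
  -- Off a measurable full-measure set of convergence the limit is replaced by `σ`, so that the
  -- result is a state at every `ω`.
  obtain ⟨S, hS, hSm, hSg⟩ := hgij.exists_measurable_mem
  classical
  refine ⟨fun ω => if ω ∈ S then Matrix.of (g ω) else σ, fun i j => ?_, fun ω => ?_, ?_⟩
  · have h : Measurable fun ω => if ω ∈ S then g ω i j else σ i j :=
      Measurable.ite hSm ((measurable_pi_apply j).comp ((measurable_pi_apply i).comp hgm))
        measurable_const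
    have h2 : (fun ω => (if ω ∈ S then Matrix.of (g ω) else σ) i j)
        = fun ω => if ω ∈ S then g ω i j else σ i j := by
      ext ω
      split_ifs <;> rfl
    rw [h2]
    exact h
  · split_ifs with hω
    · exact isState_of_tendsto (fun n => (isPTP_channelProd hΦ _ _ _).isState hσ) (hSg ω hω)
    · exact hσ
  · filter_upwards [hS, hθ.quasiMeasurePreserving.ae hS] with ω hω hω'
    rw [if_pos hω, if_pos (show θ ω ∈ S from hω')]
    ext i j
    refine tendsto_nhds_unique ?_ ((hSg (θ ω) hω' i j).comp (tendsto_add_atTop_nat 1))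
    -- The pullback orbit at `θ ω` over `n + 1` steps starts at the same time as that at `ω` over
    -- `n` steps; passing to the limit gives stationarity.
    have hstep : ∀ n : ℕ, channelProd θ Φ (θ ω) (-(n + 1 : ℕ)) (n + 1) σ
        = Φ ω (channelProd θ Φ ω (-n) n σ) := by
      intro n
      rw [← shift_one (θ := θ), channelProd_shift,
        show (-((n + 1 : ℕ) : ℤ)) + 1 = -n by push_cast; ring, channelProd, neg_add_cancel,
        LinearMap.comp_apply, channelAt, shift_zero]
    simp only [Function.comp_def, hstep]
    rw [superop_apply_apply (Φ ω) (Matrix.of (g ω))]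
    refine Tendsto.congr (fun n => (superop_apply_apply (Φ ω) _ i j).symm) ?_
    exact tendsto_finsetSum _ fun k _ => tendsto_finsetSum _ fun l _ =>
      (hSg ω hω k l).mul_const _

/-- At `ω` both states are images, under the same `n` past channels, of states at time `-n`; their
distance is thus at most twice a vanishing coefficient. -/
theorem isStationaryState_ae_unique [IsProbabilityMeasure μ]
    (hθ : MeasurePreserving θ μ μ) (hΦm : Measurable Φ) (hΦ : ∀ ω, IsPTP (Φ ω))
    (hlyap : ∀ᵐ ω ∂μ, lyapunovTr θ Φ ω < 0) {ρ ρ' : Ω → Mat d}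
    (hρ : IsStationaryState μ θ Φ ρ) (hρ' : IsStationaryState μ θ Φ ρ') : ρ' =ᵐ[μ] ρ := by
  filter_upwards [ae_tendsto_contraction_pullback hθ hΦm hΦ hlyap, hρ.ae_channelProd hθ,
    hρ'.ae_channelProd hθ] with ω hω h1 h2
  have h : traceNorm (ρ' ω - ρ ω) ≤ 0 := by
    refine ge_of_tendsto' (by simpa using hω.const_mul 2) fun n => ?_
    have e1 := h1 (-n) n
    have e2 := h2 (-n) n
    rw [neg_add_cancel, shift_zero] at e1 e2
    rw [← e1, ← e2]
    exact traceNorm_map_sub_le_of_isState _ (hρ'.isState _) (hρ.isState _)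
  exact sub_eq_zero.1 (traceNorm_eq_zero.1 (le_antisymm h (traceNorm_nonneg _)))

/-! ### Replacement error bounded by the contraction coefficients -/

lemma replacementError_eq (ρ : Ω → Mat d) (n : ℕ) (ω : Ω) : replacementError θ Φ ρ n ω =
    max (oneOneNorm (channelProd θ Φ ω 0 n - replacement (ρ (shift θ n ω))))
      (oneOneNorm (channelProd θ Φ ω (-n) n - replacement (ρ ω))) := by
  rw [replacementError, propagator_zero_right, propagator_zero_left]

lemma measurable_replacementError (hθ : MeasurePreserving θ μ μ) (hΦ : Measurable Φ)
    {ρ : Ω → Mat d} (hρ : IsStationaryState μ θ Φ ρ) (n : ℕ) :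
    Measurable (replacementError θ Φ ρ n) := by
  have hdiff : ∀ (s : ℤ) (τ : Ω → Mat d), (∀ i j, Measurable fun ω => τ ω i j) →
      Measurable fun ω => oneOneNorm (channelProd θ Φ ω s n - replacement (τ ω)) := by
    intro s τ hτ
    refine measurable_oneOneNorm.comp (measurable_superop_iff.2 fun X i j => ?_)
    have h1 := measurable_superop_iff.1 (measurable_channelProd hθ hΦ s n) X i j
    exact h1.sub ((hτ i j).const_mul X.trace)
  rw [show replacementError θ Φ ρ n = _ from funext fun ω => replacementError_eq ρ n ω]
  exact (hdiff 0 _ fun i j =>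
    (hρ.measurable i j).comp (measurePreserving_shift hθ n).measurable).max
    (hdiff (-n) _ hρ.measurable)

lemma ae_replacementError_le (hθ : MeasurePreserving θ μ μ) {ρ : Ω → Mat d}
    (hρ : IsStationaryState μ θ Φ ρ) : ∀ᵐ ω ∂μ, ∀ n : ℕ,
      replacementError θ Φ ρ n ω ≤ 4 * (contraction θ Φ 0 n ω + contraction θ Φ (-n) n ω) := by
  filter_upwards [hρ.ae_channelProd hθ] with ω hω n
  have e1 := hω 0 n
  have e2 := hω (-n) n
  rw [zero_add] at e1
  rw [neg_add_cancel, shift_zero] at e2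
  rw [replacementError_eq, ← e2, ← e1]
  have h1 := contraction_nonneg (θ := θ) (Φ := Φ) 0 n ω
  have h2 := contraction_nonneg (θ := θ) (Φ := Φ) (-n) n ω
  refine max_le ((oneOneNorm_sub_replacement_le _ (hρ.isState _)).trans ?_)
    ((oneOneNorm_sub_replacement_le _ (hρ.isState _)).trans ?_)
  · simp only [contraction] at h1 h2 ⊢
    linarith
  · simp only [contraction] at h1 h2 ⊢
    linarith

lemma integrable_replacementError [IsProbabilityMeasure μ] (hθ : MeasurePreserving θ μ μ)
    (hΦm : Measurable Φ) (hΦ : ∀ ω, IsPTP (Φ ω)) {ρ : Ω → Mat d}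
    (hρ : IsStationaryState μ θ Φ ρ) (n : ℕ) : Integrable (replacementError θ Φ ρ n) μ := by
  refine Integrable.of_bound (measurable_replacementError hθ hΦm hρ n).aestronglyMeasurable 8 ?_
  filter_upwards [ae_replacementError_le hθ hρ] with ω hω
  have h0 : 0 ≤ replacementError θ Φ ρ n ω := le_max_of_le_left (oneOneNorm_nonneg _)
  rw [Real.norm_of_nonneg h0]
  linarith [hω n, contraction_le_one (θ := θ) hΦ 0 n ω, contraction_le_one (θ := θ) hΦ (-n) n ω]

lemma integral_replacementError_le [IsProbabilityMeasure μ] (hθ : MeasurePreserving θ μ μ)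
    (hΦm : Measurable Φ) (hΦ : ∀ ω, IsPTP (Φ ω)) {ρ : Ω → Mat d}
    (hρ : IsStationaryState μ θ Φ ρ) (n : ℕ) :
    ∫ ω, replacementError θ Φ ρ n ω ∂μ ≤ 8 * ∫ ω, contraction θ Φ 0 n ω ∂μ := by
  have hi := integrable_contraction (μ := μ) hθ hΦm hΦ
  have h := integral_mono_ae (integrable_replacementError hθ hΦm hΦ hρ n)
    (((hi 0 n).add (hi (-n) n)).const_mul 4)
    ((ae_replacementError_le hθ hρ).mono fun ω hω => hω n)
  rw [integral_const_mul] at h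
  simp only [Pi.add_apply] at h
  rw [integral_add (hi 0 n) (hi (-n) n), integral_contraction hθ hΦm (-n) n] at h
  linarith

end CocycleLemmas

/-! ### Decay of sequences from approximate or exact submultiplicativity -/

section Decay

/-- Super-polynomial decay from an approximate doubling inequality. -/
lemma exists_le_div_pow_of_doubling {x r : ℕ → ℝ} (hx : Antitone x) (hx0 : ∀ n, 0 ≤ x n)
    (hx1 : ∀ n, x n ≤ 1) (hlim : Tendsto x atTop (𝓝 0)) (hr : Tendsto r atTop (𝓝 0))
    (h : ∀ a m, x (a + m + a) ≤ x a * x a + r m * x a) (p : ℕ) :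
    ∃ C : ℝ, ∀ n : ℕ, 1 ≤ n → x n ≤ C / (n : ℝ) ^ p := by
  have hδ : (0 : ℝ) < 1 / 4 ^ p / 2 := by positivity
  obtain ⟨m, hm⟩ := (hr.eventually_lt_const hδ).exists
  obtain ⟨A, hA⟩ := (hlim.eventually_lt_const hδ).exists_forall_of_atTop
  -- For `n > M` and `a = n / 3` one has `A ≤ a`, `2a + m ≤ n` and `n ≤ 4a`. The step gains `4⁻ᵖ`,
  -- half from `x a` and half from `r m`, which pays for shrinking `n` to `a`. For `n ≤ M` the
  -- constant `M ^ p` suffices since `x ≤ 1`.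
  set M := 3 * (A + m) + 8 with hM
  refine ⟨(M : ℝ) ^ p, fun n => ?_⟩
  induction n using Nat.strong_induction_on with
  | _ n ih =>
    intro hn
    have hn0 : (0 : ℝ) < n := by exact_mod_cast hn
    by_cases hnM : n ≤ M
    · refine (hx1 n).trans ?_
      rw [one_le_div (by positivity)]
      gcongr
    push Not at hnM
    have ha : 1 ≤ n / 3 := by omega
    have hstep : x n ≤ 1 / 4 ^ p * x (n / 3) := by
      have h1 := hx (show n / 3 + m + n / 3 ≤ n by omega)
      have h2 := h (n / 3) m
      have h3 := hA (n / 3) (by omega)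
      nlinarith [hx0 (n / 3)]
    refine hstep.trans ((mul_le_mul_of_nonneg_left (ih (n / 3) (by omega) ha)
      (by positivity)).trans ?_)
    have ha0 : (0 : ℝ) < (n / 3 : ℕ) := by exact_mod_cast ha
    rw [div_mul_div_comm, one_mul, ← mul_pow]
    gcongr
    have : n ≤ 4 * (n / 3) := by omega
    exact_mod_cast this

/-- Exponential decay of a vanishing submultiplicative sequence. -/
lemma exists_le_exp_of_submultiplicative {x : ℕ → ℝ} (hx : Antitone x) (hx0 : ∀ n, 0 ≤ x n)
    (hx1 : ∀ n, x n ≤ 1) (hlim : Tendsto x atTop (𝓝 0)) (h : ∀ m n, x (m + n) ≤ x m * x n) :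
    ∃ C γ : ℝ, 0 < γ ∧ ∀ n : ℕ, x n ≤ C * Real.exp (-γ * n) := by
  obtain ⟨N, hN, hN1⟩ := ((hlim.eventually_lt_const (Real.exp_pos (-1))).and
    (eventually_ge_atTop 1)).exists
  have hN0 : (0 : ℝ) < N := by exact_mod_cast hN1
  have hpow : ∀ k : ℕ, x (N * k) ≤ Real.exp (-1) ^ k := by
    intro k
    induction k with
    | zero => simpa using hx1 0
    | succ k ih =>
      rw [mul_add, mul_one, pow_succ]
      exact (h _ _).trans (mul_le_mul ih hN.le (hx0 _) (by positivity))
  -- The prefactor `e` absorbs the incomplete last block, as `n / N - 1` is at most the integer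
  -- quotient.
  refine ⟨Real.exp 1, 1 / N, by positivity, fun n => ?_⟩
  refine (hx (Nat.mul_div_le n N)).trans ((hpow _).trans ?_)
  rw [← Real.exp_nat_mul, ← Real.exp_add]
  refine Real.exp_le_exp.2 ?_
  have h1 : (n : ℝ) < N * ((n / N : ℕ) + 1) := by
    exact_mod_cast Nat.lt_mul_div_succ n hN1
  have h2 : (n : ℝ) / N ≤ (n / N : ℕ) + 1 := by
    rw [div_le_iff₀ hN0]
    linarith
  have h3 : 1 / (N : ℝ) * n = n / N := by ring
  rw [neg_mul, h3]
  linarith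

/-! ### Mixing and independence across a gap -/

variable {Ω : Type*} {mΩ : MeasurableSpace Ω} {d : ℕ} {μ : Measure Ω}
  {θ : Ω ≃ᵐ Ω} {Φ : Ω → Superop d}

lemma measurable_contraction_past {s k : ℤ} {n : ℕ} (h : s + n ≤ k) :
    Measurable[pastSigma θ Φ k] (contraction θ Φ s n) := by
  refine measurable_kappaTr.comp
    (measurable_channelProd_of (m := pastSigma θ Φ k) (x := id) s n fun j _ hj => ?_)
  rw [measurable_iff_comap_le]
  exact le_iSup₂_of_le (f := fun j (_ : j ∈ Set.Iio k) =>
    MeasurableSpace.comap (channelAt θ Φ j) inferInstance) j (hj.trans_le h) le_rfl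

lemma measurable_contraction_future {s k : ℤ} {n : ℕ} (h : k ≤ s) :
    Measurable[futureSigma θ Φ k] (contraction θ Φ s n) := by
  refine measurable_kappaTr.comp
    (measurable_channelProd_of (m := futureSigma θ Φ k) (x := id) s n fun j hj _ => ?_)
  rw [measurable_iff_comap_le]
  exact le_iSup₂_of_le (f := fun j (_ : j ∈ Set.Ici k) =>
    MeasurableSpace.comap (channelAt θ Φ j) inferInstance) j (h.trans hj) le_rfl

lemma pastSigma_le (hθ : MeasurePreserving θ μ μ) (hΦ : Measurable Φ) (k : ℤ) :
    pastSigma θ Φ k ≤ mΩ :=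
  iSup₂_le fun j _ => (measurable_channelAt hθ hΦ j).comap_le

lemma futureSigma_le (hθ : MeasurePreserving θ μ μ) (hΦ : Measurable Φ) (k : ℤ) :
    futureSigma θ Φ k ≤ mΩ :=
  iSup₂_le fun j _ => (measurable_channelAt hθ hΦ j).comap_le

/-- This bounds the sets of correlations, so that the real suprema in `maxCorr` and `varrho` really
dominate their members. -/
lemma abs_integral_mul_le_one {U V : Ω → ℝ} (hU : MemLp U 2 μ) (hV : MemLp V 2 μ)
    (hU1 : ∫ ω, U ω ^ 2 ∂μ = 1) (hV1 : ∫ ω, V ω ^ 2 ∂μ = 1) : |∫ ω, U ω * V ω ∂μ| ≤ 1 := by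
  have h := integral_mono (hU.integrable_mul hV).abs
    ((hU.integrable_sq.add hV.integrable_sq).div_const 2) fun ω => by
      simp only [Pi.mul_apply, Pi.add_apply, abs_mul]
      nlinarith [sq_nonneg (|U ω| - |V ω|), sq_abs (U ω), sq_abs (V ω)]
  rw [integral_div] at h
  simp only [Pi.mul_apply, Pi.add_apply] at h
  rw [integral_add hU.integrable_sq hV.integrable_sq, hU1, hV1] at h
  exact abs_integral_le_integral_abs.trans (by linarith)

lemma abs_integral_mul_le_varrho {k : ℤ} {m : ℕ} {U V : Ω → ℝ}
    (hUm : Measurable[pastSigma θ Φ k] U) (hVm : Measurable[futureSigma θ Φ (k + m)] V)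
    (hU : MemLp U 2 μ) (hV : MemLp V 2 μ) (hU0 : ∫ ω, U ω ∂μ = 0) (hV0 : ∫ ω, V ω ∂μ = 0)
    (hU1 : ∫ ω, U ω ^ 2 ∂μ = 1) (hV1 : ∫ ω, V ω ^ 2 ∂μ = 1) :
    |∫ ω, U ω * V ω ∂μ| ≤ varrho μ θ Φ m := by
  have hle : maxCorr μ (pastSigma θ Φ k) (futureSigma θ Φ (k + m)) ≤ varrho μ θ Φ m := by
    refine le_ciSup (f := fun k : ℤ => maxCorr μ (pastSigma θ Φ k) (futureSigma θ Φ (k + m)))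
      ⟨1, ?_⟩ k
    rintro _ ⟨l, rfl⟩
    refine Real.sSup_le ?_ zero_le_one
    rintro _ ⟨U, V, -, -, hU, hV, -, -, hU1, hV1, rfl⟩
    exact abs_integral_mul_le_one hU hV hU1 hV1
  refine le_trans (b := maxCorr μ (pastSigma θ Φ k) (futureSigma θ Φ (k + m)))
    (le_csSup ⟨1, ?_⟩ ⟨U, V, hUm, hVm, hU, hV, hU0, hV0, hU1, hV1, rfl⟩) hle
  rintro _ ⟨U, V, -, -, hU, hV, -, -, hU1, hV1, rfl⟩
  exact abs_integral_mul_le_one hU hV hU1 hV1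

lemma varrho_nonneg (m : ℕ) : 0 ≤ varrho μ θ Φ m := by
  refine Real.iSup_nonneg fun k => Real.sSup_nonneg ?_
  rintro _ ⟨U, V, -, -, -, -, -, -, -, -, rfl⟩
  exact abs_nonneg _

/-- Covariance bound for past and future observables with values in `[0, 1]`. -/
lemma integral_mul_le_varrho [IsProbabilityMeasure μ] (hθ : MeasurePreserving θ μ μ)
    (hΦ : Measurable Φ) {k : ℤ} {m : ℕ} {f g : Ω → ℝ}
    (hfm : Measurable[pastSigma θ Φ k] f) (hgm : Measurable[futureSigma θ Φ (k + m)] g)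
    (hf0 : ∀ ω, 0 ≤ f ω) (hf1 : ∀ ω, f ω ≤ 1) (hg0 : ∀ ω, 0 ≤ g ω) (hg1 : ∀ ω, g ω ≤ 1) :
    ∫ ω, f ω * g ω ∂μ ≤ (∫ ω, f ω ∂μ) * (∫ ω, g ω ∂μ) +
      varrho μ θ Φ m * (√(∫ ω, f ω ∂μ) * √(∫ ω, g ω ∂μ)) := by
  have hLp : ∀ {h : Ω → ℝ}, Measurable h → (∀ ω, 0 ≤ h ω) → (∀ ω, h ω ≤ 1) → MemLp h 2 μ :=
    fun hm h0 h1 => MemLp.of_bound hm.aestronglyMeasurable 1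
      (Eventually.of_forall fun ω => by rw [Real.norm_of_nonneg (h0 ω)]; exact h1 ω)
  have hfL := hLp (hfm.mono (pastSigma_le hθ hΦ k) le_rfl) hf0 hf1
  have hgL := hLp (hgm.mono (futureSigma_le hθ hΦ (k + m)) le_rfl) hg0 hg1
  have hfi := hfL.integrable one_le_two
  have hgi := hgL.integrable one_le_two
  set a := ∫ ω, f ω ∂μ with ha
  set b := ∫ ω, g ω ∂μ with hb
  -- Since `h² ≤ h` on `[0,1]`, the variance is at most the mean; this makes the error term linear
  -- in the mean contraction.
  have hvar : ∀ {h : Ω → ℝ}, MemLp h 2 μ → (∀ ω, 0 ≤ h ω) → (∀ ω, h ω ≤ 1) →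
      ∫ ω, (h ω - ∫ ω, h ω ∂μ) ^ 2 ∂μ ≤ ∫ ω, h ω ∂μ := by
    intro h hL h0 h1
    have hi := hL.integrable one_le_two
    set c := ∫ ω, h ω ∂μ with hc
    have e : ∀ ω, (h ω - c) ^ 2 ≤ h ω - 2 * c * h ω + c ^ 2 := fun ω => by
      nlinarith [h0 ω, h1 ω, mul_nonneg (h0 ω) (sub_nonneg.2 (h1 ω))]
    have hi1 : Integrable (fun ω => h ω - 2 * c * h ω) μ := hi.sub (hi.const_mul _)
    have hi2 : Integrable (fun ω => h ω - 2 * c * h ω + c ^ 2) μ :=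
      hi1.add (integrable_const _)
    refine (integral_mono (hL.sub (memLp_const c)).integrable_sq hi2 e).trans ?_
    rw [integral_add hi1 (integrable_const _),
      integral_sub hi (hi.const_mul _), integral_const_mul, integral_const, ← hc]
    simp only [probReal_univ, smul_eq_mul]
    nlinarith [sq_nonneg c]
  have hU0L : MemLp (fun ω => f ω - a) 2 μ := hfL.sub (memLp_const a)
  have hV0L : MemLp (fun ω => g ω - b) 2 μ := hgL.sub (memLp_const b)
  have hcov : ∫ ω, f ω * g ω ∂μ = a * b + ∫ ω, (f ω - a) * (g ω - b) ∂μ := by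
    have hfg : Integrable (fun ω => f ω * g ω) μ := hfL.integrable_mul hgL
    have e : ∀ ω, (f ω - a) * (g ω - b) = f ω * g ω - (b * f ω + a * g ω - a * b) := fun ω => by
      ring
    have hi : Integrable (fun ω => b * f ω + a * g ω) μ :=
      (hfi.const_mul b).add (hgi.const_mul a)
    have hi1 : Integrable (fun ω => b * f ω + a * g ω - a * b) μ := hi.sub (integrable_const _)
    simp only [e]
    rw [integral_sub hfg hi1, integral_sub hi (integrable_const _),
      integral_add (hfi.const_mul b) (hgi.const_mul a), integral_const_mul, integral_const_mul,
      integral_const, ← ha, ← hb]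
    simp only [probReal_univ, smul_eq_mul]
    ring
  rw [hcov]
  refine add_le_add le_rfl ?_
  set s := √(∫ ω, (f ω - a) ^ 2 ∂μ) with hs
  set t := √(∫ ω, (g ω - b) ^ 2 ∂μ) with ht
  have hs2 : ∫ ω, (f ω - a) ^ 2 ∂μ = s ^ 2 :=
    (Real.sq_sqrt (integral_nonneg fun ω => sq_nonneg _)).symm
  have ht2 : ∫ ω, (g ω - b) ^ 2 ∂μ = t ^ 2 :=
    (Real.sq_sqrt (integral_nonneg fun ω => sq_nonneg _)).symm
  have hsa : s ≤ √a := Real.sqrt_le_sqrt (hvar hfL hf0 hf1)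
  have htb : t ≤ √b := Real.sqrt_le_sqrt (hvar hgL hg0 hg1)
  have hs0 : 0 ≤ s := Real.sqrt_nonneg _
  have ht0 : 0 ≤ t := Real.sqrt_nonneg _
  have hrhs : 0 ≤ varrho μ θ Φ m * (√a * √b) :=
    mul_nonneg (varrho_nonneg m) (by positivity)
  have hdeg : ∀ {h : Ω → ℝ}, MemLp h 2 μ → ∫ ω, h ω ^ 2 ∂μ = 0 → h =ᵐ[μ] 0 := by
    intro h hL h0
    have := (integral_eq_zero_iff_of_nonneg (fun ω => sq_nonneg (h ω)) hL.integrable_sq).1 h0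
    filter_upwards [this] with ω hω
    exact pow_eq_zero_iff two_ne_zero |>.1 hω
  -- A variable of zero variance cannot be normalised, but it is almost surely constant and the
  -- covariance vanishes.
  rcases hs0.eq_or_lt with hs' | hs'
  · have h0 := hdeg hU0L (by rw [hs2, ← hs']; ring)
    rw [integral_eq_zero_of_ae]
    · exact hrhs
    · filter_upwards [h0] with ω hω
      have hω' : f ω - a = 0 := hω
      simp [hω']
  rcases ht0.eq_or_lt with ht' | ht'
  · have h0 := hdeg hV0L (by rw [ht2, ← ht']; ring)
    rw [integral_eq_zero_of_ae]
    · exact hrhs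
    · filter_upwards [h0] with ω hω
      have hω' : g ω - b = 0 := hω
      simp [hω']
  have key := abs_integral_mul_le_varrho (μ := μ) (k := k) (m := m) (θ := θ) (Φ := Φ)
    (U := fun ω => s⁻¹ * (f ω - a)) (V := fun ω => t⁻¹ * (g ω - b))
    ((hfm.sub_const a).const_mul _) ((hgm.sub_const b).const_mul _)
    (hU0L.const_mul _) (hV0L.const_mul _)
    (by rw [integral_const_mul, integral_sub hfi (integrable_const _), ← ha]; simp)
    (by rw [integral_const_mul, integral_sub hgi (integrable_const _), ← hb]; simp)
    (by simp only [mul_pow]; rw [integral_const_mul, hs2]; field_simp)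
    (by simp only [mul_pow]; rw [integral_const_mul, ht2]; field_simp)
  have e : ∀ ω, s⁻¹ * (f ω - a) * (t⁻¹ * (g ω - b)) = (s * t)⁻¹ * ((f ω - a) * (g ω - b)) :=
    fun ω => by rw [mul_inv]; ring
  simp only [e] at key
  rw [integral_const_mul] at key
  have hst : 0 < s * t := mul_pos hs' ht'
  have key2 := (le_abs_self _).trans key
  rw [inv_mul_le_iff₀ hst] at key2
  refine key2.trans ?_
  rw [mul_comm]
  exact mul_le_mul_of_nonneg_left (mul_le_mul hsa htb ht0 (Real.sqrt_nonneg _)) (varrho_nonneg m)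

lemma integral_contraction_nonneg (s : ℤ) (n : ℕ) : 0 ≤ ∫ ω, contraction θ Φ s n ω ∂μ :=
  integral_nonneg fun _ => contraction_nonneg _ _ _

lemma integral_contraction_le_one [IsProbabilityMeasure μ] (hθ : MeasurePreserving θ μ μ)
    (hΦm : Measurable Φ) (hΦ : ∀ ω, IsPTP (Φ ω)) (s : ℤ) (n : ℕ) :
    ∫ ω, contraction θ Φ s n ω ∂μ ≤ 1 := by
  have := integral_mono (integrable_contraction hθ hΦm hΦ s n) (integrable_const (1 : ℝ))
    (μ := μ) (contraction_le_one hΦ s n)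
  simpa using this

lemma antitone_integral_contraction [IsProbabilityMeasure μ] (hθ : MeasurePreserving θ μ μ)
    (hΦm : Measurable Φ) (hΦ : ∀ ω, IsPTP (Φ ω)) :
    Antitone fun n => ∫ ω, contraction θ Φ 0 n ω ∂μ := fun m n hmn =>
  integral_mono (integrable_contraction hθ hΦm hΦ 0 n) (integrable_contraction hθ hΦm hΦ 0 m)
    fun ω => antitone_contraction hΦ 0 ω hmn

lemma integrable_contraction_mul [IsProbabilityMeasure μ] (hθ : MeasurePreserving θ μ μ)
    (hΦm : Measurable Φ) (hΦ : ∀ ω, IsPTP (Φ ω)) (s t : ℤ) (m n : ℕ) :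
    Integrable (fun ω => contraction θ Φ s m ω * contraction θ Φ t n ω) μ :=
  integrable_of_mem_Icc
    ((measurable_contraction hθ hΦm s m).mul (measurable_contraction hθ hΦm t n))
    (fun ω => mul_nonneg (contraction_nonneg s m ω) (contraction_nonneg t n ω))
    (fun ω => mul_le_one₀ (contraction_le_one hΦ s m ω) (contraction_nonneg t n ω)
      (contraction_le_one hΦ t n ω))

/-- Approximate submultiplicativity of the mean contraction coefficient across a gap. -/
lemma integral_contraction_gap_le [IsProbabilityMeasure μ] (hθ : MeasurePreserving θ μ μ)
    (hΦm : Measurable Φ) (hΦ : ∀ ω, IsPTP (Φ ω)) (a m : ℕ) :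
    ∫ ω, contraction θ Φ 0 (a + m + a) ω ∂μ ≤
      (∫ ω, contraction θ Φ 0 a ω ∂μ) * (∫ ω, contraction θ Φ 0 a ω ∂μ) +
        varrho μ θ Φ m * ∫ ω, contraction θ Φ 0 a ω ∂μ := by
  -- The `m` channels in the gap are discarded by monotonicity, leaving one factor in the past of
  -- time `a` and one in the future of `a + m`.
  have hpt : ∀ ω, contraction θ Φ 0 (a + m + a) ω ≤
      contraction θ Φ 0 a ω * contraction θ Φ (a + m) a ω := fun ω => by
    refine (contraction_add_le hΦ 0 (a + m) a ω).trans ?_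
    rw [mul_comm, zero_add]
    push_cast
    exact mul_le_mul_of_nonneg_right (antitone_contraction hΦ 0 ω (Nat.le_add_right a m))
      (contraction_nonneg _ _ _)
  have h := integral_mul_le_varrho (μ := μ) (k := a) (m := m) hθ hΦm
    (measurable_contraction_past (Φ := Φ) (s := 0) (n := a) (zero_add _).le)
    (measurable_contraction_future (n := a) le_rfl)
    (contraction_nonneg _ _) (contraction_le_one hΦ _ _) (contraction_nonneg _ _)
    (contraction_le_one hΦ _ _)
  rw [integral_contraction hθ hΦm (a + m) a,
    Real.mul_self_sqrt (integral_contraction_nonneg _ _)] at h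
  exact (integral_mono (integrable_contraction hθ hΦm hΦ _ _)
    (integrable_contraction_mul hθ hΦm hΦ _ _ _ _) hpt).trans h

/-- Submultiplicativity of the mean contraction coefficient in an independent environment. -/
lemma integral_contraction_add_le [IsProbabilityMeasure μ] (hθ : MeasurePreserving θ μ μ)
    (hΦm : Measurable Φ) (hΦ : ∀ ω, IsPTP (Φ ω)) (hind : iIndepFun (channelAt θ Φ) μ) (m n : ℕ) :
    ∫ ω, contraction θ Φ 0 (m + n) ω ∂μ ≤
      (∫ ω, contraction θ Φ 0 m ω ∂μ) * (∫ ω, contraction θ Φ 0 n ω ∂μ) := by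
  have hσ : Indep (pastSigma θ Φ m) (futureSigma θ Φ m) μ :=
    indep_iSup_of_disjoint (fun j => (measurable_channelAt hθ hΦm j).comap_le) hind
      (Set.disjoint_left.2 fun j hj hj' => not_lt.2 (Set.mem_Ici.1 hj') (Set.mem_Iio.1 hj))
  have hI : IndepFun (contraction θ Φ 0 m) (contraction θ Φ m n) μ :=
    indep_of_indep_of_le_left (indep_of_indep_of_le_right hσ
      (measurable_contraction_future le_rfl).comap_le)
      (measurable_contraction_past (zero_add _).le).comap_le
  rw [← integral_contraction hθ hΦm m n, ← hI.integral_fun_mul_eq_mul_integral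
    (measurable_contraction hθ hΦm _ _).aestronglyMeasurable
    (measurable_contraction hθ hΦm _ _).aestronglyMeasurable]
  refine integral_mono (integrable_contraction hθ hΦm hΦ _ _)
    (integrable_contraction_mul hθ hΦm hΦ _ _ _ _) fun ω => ?_
  have := contraction_add_le (θ := θ) hΦ 0 m n ω
  rwa [zero_add, mul_comm] at this

end Decay

end RandomChannels

theorem mainTheorem6 {Ω : Type*} [MeasurableSpace Ω] (μ : Measure Ω) [IsProbabilityMeasure μ]
    (θ : Ω ≃ᵐ Ω) (hθ : MeasurePreserving θ μ μ)
    (d : ℕ) (hd : 0 < d)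
    (Φ : Ω → Superop d) (hΦ_meas : Measurable Φ) (hΦ : ∀ ω, IsCPTP (Φ ω))
    (hlyap : ∀ᵐ ω ∂μ, lyapunovTr θ Φ ω < 0) :
    -- the stationary random state exists and is almost surely unique
    (∃ ρ : Ω → Mat d, IsStationaryState μ θ Φ ρ ∧
      ∀ ρ' : Ω → Mat d, IsStationaryState μ θ Φ ρ' → ρ' =ᵐ[μ] ρ) ∧
    ∀ ρ : Ω → Mat d, IsStationaryState μ θ Φ ρ →
      -- the replacement errors are integrable
      (∀ n : ℕ, 1 ≤ n → Integrable (replacementError θ Φ ρ n) μ) ∧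
      -- super-polynomial decay under mixing
      (Tendsto (varrho μ θ Φ) atTop (𝓝 0) →
        ∀ p : ℕ, ∃ C : ℝ, ∀ n : ℕ, 1 ≤ n →
          ∫ ω, replacementError θ Φ ρ n ω ∂μ ≤ C / (n : ℝ) ^ p) ∧
      -- exponential decay under independence
      (iIndepFun (channelAt θ Φ) μ →
        ∃ C γ : ℝ, 0 < γ ∧ ∀ n : ℕ, 1 ≤ n →
          ∫ ω, replacementError θ Φ ρ n ω ∂μ ≤ C * Real.exp (-γ * n)) := by
  have hP : ∀ ω, IsPTP (Φ ω) := fun ω => (hΦ ω).isPTP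
  have hanti := antitone_integral_contraction (μ := μ) hθ hΦ_meas hP
  have hlim := tendsto_integral_contraction hθ hΦ_meas hP hlyap
  refine ⟨?_, fun ρ hρ => ⟨fun n _ => integrable_replacementError hθ hΦ_meas hP hρ n, ?_, ?_⟩⟩
  · obtain ⟨ρ, hρ⟩ := exists_isStationaryState hd hθ hΦ_meas hP hlyap
    exact ⟨ρ, hρ, fun ρ' hρ' => isStationaryState_ae_unique hθ hΦ_meas hP hlyap hρ hρ'⟩
  · intro hmix p
    obtain ⟨C, hC⟩ := exists_le_div_pow_of_doubling hanti (integral_contraction_nonneg 0)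
      (integral_contraction_le_one hθ hΦ_meas hP 0) hlim hmix
      (integral_contraction_gap_le hθ hΦ_meas hP) p
    refine ⟨8 * C, fun n hn => (integral_replacementError_le hθ hΦ_meas hP hρ n).trans ?_⟩
    rw [mul_div_assoc]
    exact mul_le_mul_of_nonneg_left (hC n hn) (by norm_num)
  · intro hind
    obtain ⟨C, γ, hγ, hC⟩ := exists_le_exp_of_submultiplicative hanti
      (integral_contraction_nonneg 0) (integral_contraction_le_one hθ hΦ_meas hP 0) hlim
      (integral_contraction_add_le hθ hΦ_meas hP hind)
    refine ⟨8 * C, γ, hγ, fun n _ => (integral_replacementError_le hθ hΦ_meas hP hρ n).trans ?_⟩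
    rw [mul_assoc]
    exact mul_le_mul_of_nonneg_left (hC n) (by norm_num)
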